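/- All graphs are finite; $G$ is a simple graph, and $R$ is a multigraph (parallel edges and loops allowed). A graph $G$ is $k$-connected if $|V(G)|\ge k$ and $G-S$ is connected for every $S\subseteq V(G)$ with $|S|<k$; $\kappa(G)$ is the largest $k$ such that $G$ is $k$-connected. A subdivision of $R$ is a graph obtained from $R$ by replacing its edges with paths between the same ends (a loop being replaced with a cycle through its end) that share no vertices except ends and have no vertex of $R$ in their interiors. An $R$-subdivision in $G$ is a subgraph of $G$ that is a subdivision of $R$, and it is maximum if it has the largest number of vertices among all $R$-subdivisions in $G$. An $R$-transversal of $G$ is a set of vertices of $G$ that meets the vertex set of every maximum $R$-subdivision in $G$. Let $R$ be a multigraph with $m\ge 1$ edges, and let $G$ be an $n$-vertex graph with $\kappa(G)>m^2$. (1) If $R$ has no isolated vertices, then the maximum $R$-subdivisions in $G$ pairwise intersect: any two of them have a common vertex. (2) If $R$ is connected, then $G$ has an $R$-transversal of size at most $8\,m^{5/4}n^{3/4}$. -/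

import Mathlib

namespace Graph

universe u v w

variable {α : Type u} {β : Type v} {V : Type w}

/-- A multigraph is connected if it has a vertex and any two of its vertices are joined by a
(possibly trivial) walk. -/
def IsConnectedMultigraph (R : Graph α β) : Prop :=
  R.vertexSet.Nonempty ∧
    ∀ x ∈ R.vertexSet, ∀ y ∈ R.vertexSet, Relation.ReflTransGen R.Adj x y

/-- Every vertex is an end of some edge (a vertex whose only edges are loops is not isolated). -/
def NoIsolatedVertex (R : Graph α β) : Prop :=
  ∀ x ∈ R.vertexSet, ∃ e, R.Inc e x

/-- A realization, inside the simple graph `G`, of a subdivision of the multigraph `R`: each vertex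
of `R` is sent to a vertex of `G` (its branch vertex), and each edge of `R` is replaced by a path of
`G` between the branch vertices of its ends (by a cycle through the branch vertex, if the edge is
a loop). Distinct branch vertices are distinct, no path has a branch vertex in its interior, and
the paths of distinct edges of `R` share no edge and no vertex other than branch vertices. -/
structure SubdivisionModel (R : Graph α β) (G : SimpleGraph V) where
  /-- the branch vertices -/
  branch : R.vertexSet → V
  branch_injective : Function.Injective branch
  /-- the end of an edge at which its path is taken to start -/
  src : R.edgeSet → R.vertexSet
  /-- the end of an edge at which its path is taken to stop -/
  tgt : R.edgeSet → R.vertexSet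
  isLink : ∀ e, R.IsLink e.1 (src e).1 (tgt e).1
  /-- the path that replaces an edge -/
  walk : ∀ e, G.Walk (branch (src e)) (branch (tgt e))
  isPath : ∀ e, src e ≠ tgt e → (walk e).IsPath
  isCycle : ∀ e, ∀ h : src e = tgt e, ((walk e).copy rfl (congrArg branch h.symm)).IsCycle
  branch_mem : ∀ e x, branch x ∈ (walk e).support → x = src e ∨ x = tgt e
  support_inter : ∀ e f, e ≠ f → ∀ z, z ∈ (walk e).support → z ∈ (walk f).support →
    z ∈ Set.range branch
  edges_disjoint : ∀ e f, e ≠ f → List.Disjoint (walk e).edges (walk f).edges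

/-- The subgraph of `G` formed by the branch vertices and the paths of a realization. -/
def SubdivisionModel.toSubgraph {R : Graph α β} {G : SimpleGraph V} (M : R.SubdivisionModel G) :
    G.Subgraph where
  verts := {z | z ∈ Set.range M.branch ∨ ∃ e, z ∈ (M.walk e).support}
  Adj x y := ∃ e, s(x, y) ∈ (M.walk e).edges
  adj_sub := by
    rintro x y ⟨e, he⟩
    exact (M.walk e).adj_of_mem_edges he
  edge_vert := by
    rintro x y ⟨e, he⟩
    exact Or.inr ⟨e, (M.walk e).fst_mem_support_of_mem_edges he⟩
  symm := ⟨by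
    rintro x y ⟨e, he⟩
    exact ⟨e, by rwa [Sym2.eq_swap]⟩⟩

/-- The subgraph `F` of `G` is an `R`-subdivision. -/
def IsSubdivision (R : Graph α β) {G : SimpleGraph V} (F : G.Subgraph) : Prop :=
  ∃ M : R.SubdivisionModel G, M.toSubgraph = F

/-- `F` is a maximum `R`-subdivision in `G`: it has the most vertices among all
`R`-subdivisions in `G`. -/
def IsMaxSubdivision (R : Graph α β) {G : SimpleGraph V} (F : G.Subgraph) : Prop :=
  R.IsSubdivision F ∧ ∀ F' : G.Subgraph, R.IsSubdivision F' → F'.verts.ncard ≤ F.verts.ncard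

/-- An `R`-transversal of `G`: a set of vertices that meets every maximum `R`-subdivision. -/
def IsTransversal (R : Graph α β) (G : SimpleGraph V) (S : Finset V) : Prop :=
  ∀ F : G.Subgraph, R.IsMaxSubdivision F → ∃ z ∈ S, z ∈ F.verts

end Graph

namespace SimpleGraph

universe w

/-- `G` is `k`-connected: it has at least `k` vertices and deleting fewer than `k` vertices
always leaves a connected graph. -/
def IsVertexConnected {V : Type w} [Fintype V] (G : SimpleGraph V) (k : ℕ) : Prop :=
  k ≤ Fintype.card V ∧ ∀ S : Finset V, S.card < k → (G.induce {z | z ∉ S}).Connected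

/-- The connectivity of `G`, the largest `k` such that `G` is `k`-connected. -/
noncomputable def vertexConnectivity {V : Type w} [Fintype V] (G : SimpleGraph V) : ℕ :=
  sSup {k | G.IsVertexConnected k}

theorem isGreatest_vertexConnectivity {V : Type w} [Fintype V] (G : SimpleGraph V) :
    IsGreatest {k | G.IsVertexConnected k} G.vertexConnectivity := by
  have hne : {k | G.IsVertexConnected k}.Nonempty :=
    ⟨0, Nat.zero_le _, fun S h => absurd h (Nat.not_lt_zero _)⟩
  have hb : BddAbove {k | G.IsVertexConnected k} := ⟨Fintype.card V, fun k hk => hk.1⟩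
  exact ⟨Nat.sSup_mem hne hb, fun k hk => le_csSup hb hk⟩

end SimpleGraph

/-! Everything rests on one exchange principle: in a maximum `R`-subdivision no segment of the path
of an edge can be replaced by a longer path whose interior avoids the subdivision
(`length_le_of_isMaxSubdivision`). `HasChunks` records this after cutting the subdivision into
pieces of length less than `ℓ`.

(1) Suppose two maximum subdivisions are disjoint. Each has more than `m ^ 2` vertices, so Menger's
theorem (`exists_linkage`) gives `m ^ 2 + 1` disjoint paths between them. Two of these paths start
on the path of one edge and stop on the path of one edge. The segments that they cut off can each be
prolonged by the two linking paths into a detour for the other segment, so each segment is longer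
than the other (`HasChunks.not_disjoint`).

(2) Let `𝓕` be the family of vertex sets of maximum subdivisions: connected and, by (1), pairwise
intersecting. Suppose that every transversal has at least `t` vertices. The `cutNumber` of `X` is
monotone, subadditive and at most the size of `X`. A set of cut number less than `t` misses some
member of `𝓕`, and a set of cut number at least `k` sends `k` disjoint paths to every member. A
member has cut number at least `t` and is covered by `m` paths, so one of these has a subpath `w` of
cut number exactly `s = t / (2m)`.

Link `w` to a disjoint member `F₁` by `s` paths whose sets of first vertices keep full cut number
(`exists_linkage_forall_card_le_cutNumber`). Discard the long paths; about `2√n` of the rest end in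
one chunk of `F₁`. Closing a subpath of `w` through that chunk gives a cycle `C` that is long and of
large cut number, but has cut number less than `t`, since it adds few vertices to `w`. Hence some
member `F₂` misses `C` and receives about `2√n` disjoint paths from it, two of them in one chunk of
length at most `√n`. The longer arc of `C` between these two paths yields a detour that is too long
for `F₂` (`not_exists_large_cutNumber`). -/

namespace SimpleGraph

variable {V : Type*} {G : SimpleGraph V}

/-! ### Avoiding walks and linkages -/

/-- `x` and `y` are joined by a walk of `G` that avoids `Z`. -/
def ReachAvoiding (G : SimpleGraph V) (Z : Set V) (x y : V) : Prop :=
  ∃ p : G.Walk x y, ∀ v ∈ p.support, v ∉ Z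

namespace ReachAvoiding

variable {Z Z' : Set V} {x y z : V}

theorem refl (h : x ∉ Z) : G.ReachAvoiding Z x x := ⟨.nil, by simpa using h⟩

theorem symm (h : G.ReachAvoiding Z x y) : G.ReachAvoiding Z y x := by
  obtain ⟨p, hp⟩ := h
  exact ⟨p.reverse, by simpa using hp⟩

theorem trans (h : G.ReachAvoiding Z x y) (h' : G.ReachAvoiding Z y z) :
    G.ReachAvoiding Z x z := by
  obtain ⟨p, hp⟩ := h
  obtain ⟨q, hq⟩ := h'
  refine ⟨p.append q, fun v hv => ?_⟩
  rcases (Walk.mem_support_append_iff p q).1 hv with h | h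
  exacts [hp v h, hq v h]

theorem left_notMem (h : G.ReachAvoiding Z x y) : x ∉ Z := by
  obtain ⟨p, hp⟩ := h
  exact hp _ p.start_mem_support

theorem right_notMem (h : G.ReachAvoiding Z x y) : y ∉ Z := h.symm.left_notMem

theorem of_adj (h : G.Adj x y) (hx : x ∉ Z) (hy : y ∉ Z) : G.ReachAvoiding Z x y :=
  ⟨h.toWalk, by simp [hx, hy]⟩

theorem mono (hZ : Z' ⊆ Z) (h : G.ReachAvoiding Z x y) : G.ReachAvoiding Z' x y := by
  obtain ⟨p, hp⟩ := h
  exact ⟨p, fun v hv hv' => hp v hv (hZ hv')⟩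

end ReachAvoiding

/-- A family of pairwise disjoint paths from `A` to `B`, each of which meets `A` only in its first
and `B` only in its last vertex. -/
structure Linkage (G : SimpleGraph V) (A B : Set V) (ι : Type*) where
  /-- the first vertices -/
  a : ι → V
  /-- the last vertices -/
  b : ι → V
  /-- the paths -/
  path : ∀ i, G.Walk (a i) (b i)
  isPath : ∀ i, (path i).IsPath
  a_mem : ∀ i, a i ∈ A
  b_mem : ∀ i, b i ∈ B
  disj : ∀ i j v, v ∈ (path i).support → v ∈ (path j).support → i = j
  eq_a : ∀ i v, v ∈ (path i).support → v ∈ A → v = a i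
  eq_b : ∀ i v, v ∈ (path i).support → v ∈ B → v = b i

theorem Walk.exists_suffix_last_mem {u v : V} (p : G.Walk u v) (A : Set V)
    (h : ∃ w ∈ p.support, w ∈ A) :
    ∃ a ∈ A, ∃ q : G.Walk a v, q.support ⊆ p.support ∧ ∀ w ∈ q.support, w ∈ A → w = a := by
  induction p with
  | nil =>
    obtain ⟨w, hw, hwA⟩ := h
    simp only [Walk.support_nil, List.mem_singleton] at hw
    subst hw
    exact ⟨w, hwA, .nil, by simp, by simp⟩
  | @cons u x v h' p ih =>
    by_cases hp : ∃ w ∈ p.support, w ∈ A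
    · obtain ⟨a, ha, q, hq, hq'⟩ := ih hp
      exact ⟨a, ha, q, fun w hw => by simp [hq hw], hq'⟩
    · push Not at hp
      have hu : u ∈ A := by
        obtain ⟨w, hw, hwA⟩ := h
        rw [Walk.support_cons, List.mem_cons] at hw
        rcases hw with rfl | hw
        · exact hwA
        · exact absurd hwA (hp w hw)
      refine ⟨u, hu, .cons h' p, List.Subset.refl _, fun w hw hwA => ?_⟩
      rw [Walk.support_cons, List.mem_cons] at hw
      rcases hw with rfl | hw
      · rfl
      · exact absurd hwA (hp w hw)

theorem Walk.exists_trim {A B : Set V} {u v : V} (p : G.Walk u v) (hu : u ∈ A) (hv : v ∈ B) :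
    ∃ a b, ∃ q : G.Walk a b, q.IsPath ∧ a ∈ A ∧ b ∈ B ∧ q.support ⊆ p.support ∧
      (∀ w ∈ q.support, w ∈ A → w = a) ∧ ∀ w ∈ q.support, w ∈ B → w = b := by
  classical
  obtain ⟨a, ha, q, hq, hqA⟩ := p.exists_suffix_last_mem A ⟨u, p.start_mem_support, hu⟩
  obtain ⟨b, hb, r, hr, hrB⟩ := q.reverse.exists_suffix_last_mem B ⟨v, by simp, hv⟩
  have hs : r.reverse.bypass.support ⊆ r.support := fun w hw => by
    simpa using r.reverse.support_bypass_subset_support hw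
  have hs' : r.support ⊆ q.support := fun w hw => by simpa using hr hw
  exact ⟨a, b, r.reverse.bypass, Walk.bypass_isPath _, ha, hb, fun w hw => hq (hs' (hs hw)),
    fun w hw => hqA w (hs' (hs hw)), fun w hw => hrB w (hs hw)⟩

theorem Linkage.nonempty_of_walks {A B : Set V} {ι : Type*} {a b : ι → V}
    (p : ∀ i, G.Walk (a i) (b i)) (ha : ∀ i, a i ∈ A) (hb : ∀ i, b i ∈ B)
    (hd : ∀ i j v, v ∈ (p i).support → v ∈ (p j).support → i = j) :
    Nonempty (G.Linkage A B ι) := by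
  choose a' b' q hq hA hB hs hqA hqB using fun i => (p i).exists_trim (ha i) (hb i)
  exact ⟨⟨a', b', q, hq, hA, hB, fun i j v hi hj => hd i j v (hs i hi) (hs j hj), hqA, hqB⟩⟩

namespace Linkage

variable {A B : Set V} {ι : Type*}

/-- The same paths, traversed backwards. -/
def reverse (L : G.Linkage A B ι) : G.Linkage B A ι where
  a := L.b
  b := L.a
  path i := (L.path i).reverse
  isPath i := (L.isPath i).reverse
  a_mem := L.b_mem
  b_mem := L.a_mem
  disj i j v hi hj := L.disj i j v (by simpa using hi) (by simpa using hj)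
  eq_a i v hv := L.eq_b i v (by simpa using hv)
  eq_b i v hv := L.eq_a i v (by simpa using hv)

theorem a_injective (L : G.Linkage A B ι) : Function.Injective L.a := fun i j h =>
  L.disj i j (L.a i) (L.path i).start_mem_support (by rw [h]; exact (L.path j).start_mem_support)

theorem b_injective (L : G.Linkage A B ι) : Function.Injective L.b := fun i j h =>
  L.disj i j (L.b i) (L.path i).end_mem_support (by rw [h]; exact (L.path j).end_mem_support)

/-- The path meets `B`, hence `Z`, at most in its last vertex, and the part up to `v` contains that
vertex only if it is `v` itself. -/
theorem reachAvoiding (L : G.Linkage A B ι) (i : ι) {v : V} (hv : v ∈ (L.path i).support)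
    {Z : Set V} (hZ : Z ⊆ B) (hvZ : v ∉ Z) : G.ReachAvoiding Z (L.a i) v := by
  classical
  refine ⟨(L.path i).takeUntil v hv, fun w hw hwZ => ?_⟩
  have hwb := L.eq_b i w ((L.path i).support_takeUntil_subset_support hv hw) (hZ hwZ)
  subst hwb
  exact Walk.endpoint_notMem_support_takeUntil (L.isPath i) hv (fun h => hvZ (h ▸ hwZ)) hw

end Linkage

/-! ### Menger's theorem -/

theorem ReachAvoiding.deleteEdges_or {Z : Set V} {x y u v : V}
    (h : G.ReachAvoiding Z u v) : (G.deleteEdges {s(x, y)}).ReachAvoiding Z u v ∨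
      ((G.deleteEdges {s(x, y)}).ReachAvoiding Z u x ∧
        (G.deleteEdges {s(x, y)}).ReachAvoiding Z y v) ∨
      ((G.deleteEdges {s(x, y)}).ReachAvoiding Z u y ∧
        (G.deleteEdges {s(x, y)}).ReachAvoiding Z x v) := by
  obtain ⟨p, hp⟩ := h
  induction p with
  | nil => exact Or.inl (.refl (by simpa using hp))
  | @cons u w v h' p ih =>
    have hu : u ∉ Z := hp u (by simp)
    have ih := ih fun z hz => hp z (by simp [hz])
    by_cases he : s(u, w) = s(x, y)
    · rcases Sym2.eq_iff.1 he with ⟨rfl, rfl⟩ | ⟨rfl, rfl⟩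
      · rcases ih with ih | ⟨-, ih⟩ | ⟨-, ih⟩
        · exact Or.inr (Or.inl ⟨.refl hu, ih⟩)
        · exact Or.inr (Or.inl ⟨.refl hu, ih⟩)
        · exact Or.inl ih
      · rcases ih with ih | ⟨-, ih⟩ | ⟨-, ih⟩
        · exact Or.inr (Or.inr ⟨.refl hu, ih⟩)
        · exact Or.inl ih
        · exact Or.inr (Or.inr ⟨.refl hu, ih⟩)
    · have hw : w ∉ Z := hp w (by simp)
      have hr : (G.deleteEdges {s(x, y)}).ReachAvoiding Z u w :=
        .of_adj (by simp [deleteEdges_adj, h', he]) hu hw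
      rcases ih with ih | ⟨ih, ih'⟩ | ⟨ih, ih'⟩
      · exact Or.inl (hr.trans ih)
      · exact Or.inr (Or.inl ⟨hr.trans ih, ih'⟩)
      · exact Or.inr (Or.inr ⟨hr.trans ih, ih'⟩)

/-- If `Z` separates `A` from `B` once the edge `xy` is deleted and `y` is on the side of `B`, then
a set that separates `A` from `Z ∪ {x}` once `xy` is deleted separates `A` from `B`. -/
theorem not_reachAvoiding_of_deleteEdges {A B Z T : Set V} {x y b₀ : V} (hb₀ : b₀ ∈ B)
    (hZ : ∀ a ∈ A, ∀ b ∈ B, ¬ (G.deleteEdges {s(x, y)}).ReachAvoiding Z a b)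
    (hy : (G.deleteEdges {s(x, y)}).ReachAvoiding Z y b₀)
    (hT : ∀ a ∈ A, ∀ b ∈ insert x Z, ¬ (G.deleteEdges {s(x, y)}).ReachAvoiding T a b)
    {a b : V} (ha : a ∈ A) (hb : b ∈ B) : ¬ G.ReachAvoiding T a b := by
  rintro ⟨p, hp⟩
  -- Follow `p` from `a`: it cannot enter `Z ∪ {x}`, because `T` separates that set from `A`. It
  -- cannot use the edge from `y` to `x` either, since reaching `y` off `Z` would connect `A` to
  -- `b₀`. So `p` survives the deletion and avoids `Z`, against `hZ`.
  have key : ∀ {u v : V} (p : G.Walk u v), (∀ w ∈ p.support, w ∉ T) →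
      (G.deleteEdges {s(x, y)}).ReachAvoiding (insert x Z ∪ T) a u →
      (G.deleteEdges {s(x, y)}).ReachAvoiding (insert x Z ∪ T) a v := by
    intro u v p
    induction p with
    | nil => exact fun _ h => h
    | @cons u w v h' p ih =>
      intro hp hu
      have hu' := hu.right_notMem
      refine ih (fun z hz => hp z (by simp [hz])) ?_
      have hadj : (G.deleteEdges {s(x, y)}).Adj u w := by
        rw [deleteEdges_adj]
        refine ⟨h', fun he => ?_⟩
        rcases Sym2.eq_iff.1 he with ⟨rfl, rfl⟩ | ⟨rfl, rfl⟩
        · exact hu' (by simp)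
        · exact hZ a ha b₀ hb₀ ((hu.mono fun z hz => by simp [hz]).trans hy)
      have hwT : w ∉ T := hp w (by simp)
      have hw : w ∉ insert x Z := fun hw =>
        hT a ha w hw ((hu.mono Set.subset_union_right).trans
          (.of_adj hadj (fun h => hu' (Or.inr h)) hwT))
      exact hu.trans (.of_adj hadj hu' (by rintro (h | h); exacts [hw h, hwT h]))
  have haT : a ∉ T := hp a p.start_mem_support
  have haZ : a ∉ insert x Z := fun h => hT a ha a h (.refl haT)
  exact hZ a ha b hb ((key p hp (.refl (by rintro (h | h); exacts [haZ h, haT h]))).mono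
    fun z hz => by simp [hz])

theorem deleteEdges_comm_pair (x y : V) :
    G.deleteEdges {s(x, y)} = G.deleteEdges {s(y, x)} := by rw [Sym2.eq_swap]

/-- The induction step of Menger's theorem: paths from the two sides are joined at their common end
in `Z`, or across the edge `xy`. They meet nowhere else, because `Z` separates `A` from `B` in `H`.
-/
theorem Linkage.glue {k : ℕ} {A B : Set V} {Z : Finset V} {x y : V} [DecidableEq V]
    (hadj : G.Adj x y) (hyZ : y ∉ Z) {H : SimpleGraph V} (hH : H ≤ G)
    (hcard : (insert y Z).card ≤ k)
    (hZ : ∀ a ∈ A, ∀ b ∈ B, ¬ H.ReachAvoiding Z a b)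
    (L : H.Linkage A (insert x (Z : Set V)) (Fin k))
    (M : H.Linkage B (insert y (Z : Set V)) (Fin k)) :
    Nonempty (G.Linkage A B (Fin k)) := by
  have hsurj : ∀ v ∈ insert y Z, ∃ j, M.b j = v := by
    have himg : Finset.univ.image M.b = insert y Z := by
      refine Finset.eq_of_subset_of_card_le (fun v hv => ?_) ?_
      · obtain ⟨j, -, rfl⟩ := Finset.mem_image.1 hv
        simpa using M.b_mem j
      · rw [Finset.card_image_of_injective _ M.b_injective]
        simpa using hcard
    intro v hv
    rw [← himg] at hv
    simpa using hv
  have hφ : ∀ i, ∃ j, M.b j = if L.b i = x then y else L.b i := by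
    intro i
    refine hsurj _ ?_
    split_ifs with h
    · simp
    · have := L.b_mem i
      simp only [Set.mem_insert_iff, h, false_or, Finset.mem_coe] at this
      simp [this]
  choose σ hσ using hφ
  have hσinj : ∀ i j, σ i = σ j → i = j := by
    intro i j h
    have h1 := hσ i
    rw [h, hσ j] at h1
    have hi := L.b_mem i
    have hj := L.b_mem j
    simp only [Set.mem_insert_iff, Finset.mem_coe] at hi hj
    apply L.b_injective
    split_ifs at h1 with h2 h3 h3
    · rw [h2, h3]
    · exact absurd (h1 ▸ (hi.resolve_left h3)) hyZ
    · exact absurd (h1 ▸ (hj.resolve_left h2)) hyZ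
    · exact h1.symm
  have hw : ∀ i, ∃ w : G.Walk (L.a i) (M.a (σ i)), ∀ v ∈ w.support,
      v ∈ (L.path i).support ∨ v ∈ (M.path (σ i)).support := by
    intro i
    have hmid : ∃ w : G.Walk (L.b i) (M.b (σ i)), ∀ v ∈ w.support, v = L.b i ∨ v = M.b (σ i) := by
      by_cases h : L.b i = x
      · have h2 : M.b (σ i) = y := by rw [hσ i, if_pos h]
        have h3 : G.Adj (L.b i) (M.b (σ i)) := by rw [h, h2]; exact hadj
        exact ⟨h3.toWalk, by simp⟩
      · have h2 : L.b i = M.b (σ i) := by rw [hσ i, if_neg h]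
        exact ⟨Walk.nil.copy rfl h2, by simp⟩
    obtain ⟨w, hw⟩ := hmid
    refine ⟨((L.path i).mapLe hH).append (w.append ((M.path (σ i)).mapLe hH).reverse),
      fun v hv => ?_⟩
    simp only [Walk.mem_support_append_iff, Walk.support_reverse, List.mem_reverse,
      Walk.support_mapLe_eq_support] at hv
    rcases hv with hv | hv | hv
    · exact Or.inl hv
    · rcases hw v hv with rfl | rfl
      · exact Or.inl (Walk.end_mem_support _)
      · exact Or.inr (Walk.end_mem_support _)
    · exact Or.inr hv
  choose w hw using hw
  have hcross : ∀ i j v, v ∈ (L.path i).support → v ∈ (M.path (σ j)).support → i = j := by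
    intro i j v hi hj
    by_cases hvZ : v ∈ Z
    · have h1 := L.eq_b i v hi (by simp [hvZ])
      have h2 := M.eq_b _ v hj (by simp [hvZ])
      rw [hσ j] at h2
      split_ifs at h2 with h3
      · exact absurd (h2 ▸ hvZ) hyZ
      · exact L.b_injective (h1 ▸ h2)
    · have h1 := L.reachAvoiding i hi (Z := Z) (Set.subset_insert _ _) (by simpa using hvZ)
      have h2 := M.reachAvoiding _ hj (Z := Z) (Set.subset_insert _ _) (by simpa using hvZ)
      exact absurd (h1.trans h2.symm) (hZ _ (L.a_mem i) _ (M.a_mem _))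
  refine Linkage.nonempty_of_walks w L.a_mem (fun i => M.a_mem _) fun i j v hi hj => ?_
  rcases hw i v hi with hi | hi <;> rcases hw j v hj with hj | hj
  · exact L.disj i j v hi hj
  · exact hcross i j v hi hj
  · exact (hcross j i v hj hi).symm
  · exact hσinj i j (M.disj _ _ v hi hj)

/-- Menger's theorem. -/
theorem exists_linkage [Finite V] (G : SimpleGraph V) (A B : Set V) (k : ℕ)
    (h : ∀ Z : Finset V, (∀ a ∈ A, ∀ b ∈ B, ¬ G.ReachAvoiding Z a b) → k ≤ Z.card) :
    Nonempty (G.Linkage A B (Fin k)) := by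
  classical
  have := Fintype.ofFinite V
  obtain ⟨N, hN⟩ : ∃ N, G.edgeSet.ncard = N := ⟨_, rfl⟩
  induction N using Nat.strong_induction_on generalizing G A B with
  | _ N ih =>
  by_cases hE : G.edgeSet = ∅
  · have hAB : k ≤ ((A ∩ B).toFinset).card := by
      refine h _ fun a ha b hb hr => ?_
      obtain ⟨p, hp⟩ := hr
      cases p with
      | nil => exact hp a (by simp) (by simp [ha, hb])
      | cons h' p =>
        have : s(_, _) ∈ G.edgeSet := h'
        simp [hE] at this
    obtain ⟨f⟩ : Nonempty (Fin k ↪ (A ∩ B).toFinset) :=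
      Function.Embedding.nonempty_of_card_le (by rw [Fintype.card_fin, Fintype.card_coe]; exact hAB)
    have hf : ∀ i, (f i).1 ∈ A ∩ B := fun i => Set.mem_toFinset.1 (f i).2
    exact Linkage.nonempty_of_walks (fun i => (Walk.nil : G.Walk (f i).1 (f i).1))
      (fun i => (hf i).1) (fun i => (hf i).2) (by
        intro i j v hi hj
        simp only [Walk.support_nil, List.mem_singleton] at hi hj
        exact f.injective (Subtype.ext (hi ▸ hj)))
  · obtain ⟨e, he⟩ := Set.nonempty_iff_ne_empty.2 hE
    induction e with
    | _ x y =>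
    have hlt : (G.deleteEdges {s(x, y)}).edgeSet.ncard < N := by
      rw [← hN, edgeSet_deleteEdges]
      exact Set.ncard_lt_ncard ⟨Set.sdiff_subset, fun hs => (hs he).2 rfl⟩ (Set.toFinite _)
    have hle : G.deleteEdges {s(x, y)} ≤ G := deleteEdges_le _
    by_cases h' : ∀ Z : Finset V,
        (∀ a ∈ A, ∀ b ∈ B, ¬ (G.deleteEdges {s(x, y)}).ReachAvoiding Z a b) → k ≤ Z.card
    · obtain ⟨L⟩ := ih _ hlt _ A B h' rfl
      exact Linkage.nonempty_of_walks (fun i => (L.path i).mapLe hle) L.a_mem L.b_mem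
        (fun i j v hi hj => L.disj i j v (by simpa using hi) (by simpa using hj))
    · push Not at h'
      obtain ⟨Z, hZ, hZk⟩ := h'
      -- Here `Z` has fewer than `k` vertices, so it leaves an `A`-`B` walk in `G`, which must use
      -- the edge. As the direction of use is not known, `main` is stated for either orientation.
      have main : ∀ x y : V, G.Adj x y → (G.deleteEdges {s(x, y)}).edgeSet.ncard < N →
          (∀ a ∈ A, ∀ b ∈ B, ¬ (G.deleteEdges {s(x, y)}).ReachAvoiding Z a b) →
          (∃ a ∈ A, (G.deleteEdges {s(x, y)}).ReachAvoiding Z a x) →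
          (∃ b ∈ B, (G.deleteEdges {s(x, y)}).ReachAvoiding Z y b) →
          Nonempty (G.Linkage A B (Fin k)) := by
        rintro x y hxy hlt hZ ⟨a, ha, hax⟩ ⟨b, hb, hyb⟩
        obtain ⟨L⟩ := ih _ hlt _ A (insert x (Z : Set V)) (fun T hT => h T fun a' ha' b' hb' =>
          not_reachAvoiding_of_deleteEdges hb hZ hyb hT ha' hb') rfl
        obtain ⟨M⟩ := ih _ hlt _ B (insert y (Z : Set V)) (fun T hT => h T fun a' ha' b' hb' hr => by
          rw [deleteEdges_comm_pair] at hZ hax hT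
          exact not_reachAvoiding_of_deleteEdges ha (fun b hb a ha hr => hZ a ha b hb hr.symm)
            hax.symm hT hb' ha' hr.symm) rfl
        exact Linkage.glue hxy (by simpa using hyb.left_notMem) (deleteEdges_le _)
          ((Finset.card_insert_le _ _).trans hZk) hZ L M
      obtain ⟨a, ha, b, hb, hr⟩ : ∃ a ∈ A, ∃ b ∈ B, G.ReachAvoiding Z a b := by
        by_contra hcon
        push Not at hcon
        exact absurd (h Z hcon) (by omega)
      rcases hr.deleteEdges_or (x := x) (y := y) with hr | ⟨h1, h2⟩ | ⟨h1, h2⟩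
      · exact absurd hr (hZ a ha b hb)
      · exact main x y he hlt hZ ⟨a, ha, h1⟩ ⟨b, hb, h2⟩
      · rw [deleteEdges_comm_pair] at hlt hZ h1 h2
        exact main y x he.symm hlt hZ ⟨a, ha, h1⟩ ⟨b, hb, h2⟩

end SimpleGraph

namespace SimpleGraph

variable {V : Type*} {G : SimpleGraph V}

/-! ### Walks that are paths or cycles -/

/-- A path between distinct vertices, or a cycle. -/
def Walk.IsPathOrCycle {u v : V} (p : G.Walk u v) : Prop :=
  (u ≠ v ∧ p.IsPath) ∨ ∃ h : v = u, (p.copy rfl h).IsCycle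

theorem Walk.exists_getVert_of_mem_tail_support {u v w : V} {p : G.Walk u v}
    (h : w ∈ p.support.tail) : ∃ k, 1 ≤ k ∧ k ≤ p.length ∧ p.getVert k = w := by
  cases p with
  | nil => simp at h
  | cons h' q =>
    obtain ⟨n, hn, hn'⟩ := Walk.mem_support_iff_exists_getVert.1 (by simpa using h)
    exact ⟨n + 1, by omega, by simpa using hn', by simpa using hn⟩

theorem Walk.start_notMem_tail_support {u v : V} {p : G.Walk u v} (hp : p.IsPath) :
    u ∉ p.support.tail := by
  have := hp.support_nodup
  rw [← Walk.cons_tail_support] at this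
  exact (List.nodup_cons.1 this).1

namespace Walk.IsPathOrCycle

variable {u v : V} {p : G.Walk u v}

theorem length_pos (h : p.IsPathOrCycle) : 0 < p.length := by
  rcases h with ⟨h, -⟩ | ⟨rfl, h⟩
  · by_contra hp
    exact h (Walk.eq_of_length_eq_zero (p := p) (by omega))
  · have := h.three_le_length
    simp only [Walk.copy_rfl_rfl] at this
    omega

theorem isPath_take (h : p.IsPathOrCycle) {n : ℕ} (hn : n < p.length) : (p.take n).IsPath := by
  rcases h with ⟨-, h⟩ | ⟨rfl, h⟩
  · exact h.take n
  · exact Walk.IsCycle.isPath_take (by simpa using h) hn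

theorem isPath_drop (h : p.IsPathOrCycle) {n : ℕ} (hn : 0 < n) : (p.drop n).IsPath := by
  rcases h with ⟨-, h⟩ | ⟨rfl, h⟩
  · exact h.drop n
  · exact Walk.IsCycle.isPath_drop (by simpa using h) hn

/-- Position 0 is left out because on a cycle it repeats the last one. -/
theorem getVert_injOn (h : p.IsPathOrCycle) : Set.InjOn p.getVert {i | 1 ≤ i ∧ i ≤ p.length} := by
  rcases h with ⟨-, h⟩ | ⟨rfl, h⟩
  · exact h.getVert_injOn.mono fun i hi => hi.2
  · exact Walk.IsCycle.getVert_injOn (by simpa using h)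

theorem eq_of_getVert_eq (h : p.IsPathOrCycle) {i j : ℕ} (hi : 0 < i) (hi' : i < p.length)
    (hj : j ≤ p.length) (hij : p.getVert i = p.getVert j) : i = j := by
  rcases h with ⟨-, h⟩ | ⟨rfl, h⟩
  · exact h.getVert_injOn hi'.le hj hij
  · have h : p.IsCycle := by simpa using h
    rcases Nat.eq_zero_or_pos j with rfl | hj'
    · exact h.getVert_injOn' (by simp only [Set.mem_ofPred_eq]; omega) (by simp) hij
    · exact h.getVert_injOn ⟨hi, hi'.le⟩ ⟨hj', hj⟩ hij

theorem exists_segment (h : p.IsPathOrCycle) {i j : ℕ} (hij : i < j) (hj : j ≤ p.length)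
    (hne : p.getVert i ≠ p.getVert j) :
    ∃ q : G.Walk (p.getVert i) (p.getVert j), q.IsPath ∧ q.length = j - i ∧
      q.support ⊆ p.support := by
  rcases Nat.eq_zero_or_pos i with rfl | hi
  · rcases hj.lt_or_eq with hj | rfl
    · refine ⟨(p.take j).copy (by simp) rfl, ?_, ?_, ?_⟩
      · simpa using h.isPath_take hj
      · simp [hj.le]
      · rw [Walk.support_copy, Walk.support_take]
        exact List.take_subset _ _
    · rcases h with ⟨-, h⟩ | ⟨rfl, h⟩
      · exact ⟨p.copy (by simp) (by simp), by simpa using h, by simp, by simp⟩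
      · simp at hne
  · have he : (p.drop i).getVert (j - i) = p.getVert j := by
      rw [Walk.drop_getVert]
      congr 1
      omega
    refine ⟨((p.drop i).take (j - i)).copy rfl he, ?_, ?_, ?_⟩
    · simpa using (h.isPath_drop hi).take _
    · simp only [Walk.length_copy, Walk.take_length, Walk.drop_length]
      omega
    · rw [Walk.support_copy, Walk.support_take, Walk.drop_support_eq_support_drop_min]
      exact fun w hw => List.drop_subset _ _ (List.take_subset _ _ hw)

/-- The three parts meet only at the splicing points, so the vertices after the first are distinct.
The strict gain in length keeps a closed walk at three or more edges. -/
theorem splice (h : p.IsPathOrCycle) {i j : ℕ} (hij : i < j) (hj : j ≤ p.length)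
    {r : G.Walk (p.getVert i) (p.getVert j)} (hr : r.IsPath)
    (hrp : ∀ w ∈ r.support, w ∈ p.support → w = p.getVert i ∨ w = p.getVert j)
    (hlen : j - i < r.length) : (((p.take i).append r).append (p.drop j)).IsPathOrCycle := by
  have hA : ∀ w ∈ (p.take i).support.tail, ∃ k, 1 ≤ k ∧ k ≤ i ∧ p.getVert k = w := by
    intro w hw
    obtain ⟨k, h1, h2, h3⟩ := Walk.exists_getVert_of_mem_tail_support hw
    simp only [Walk.take_length, Walk.take_getVert] at h2 h3
    exact ⟨k, h1, by omega, by rwa [min_eq_right (by omega)] at h3⟩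
  have hC : ∀ w ∈ (p.drop j).support.tail, ∃ k, j < k ∧ k ≤ p.length ∧ p.getVert k = w := by
    intro w hw
    obtain ⟨k, h1, h2, h3⟩ := Walk.exists_getVert_of_mem_tail_support hw
    simp only [Walk.drop_length, Walk.drop_getVert] at h2 h3
    exact ⟨j + k, by omega, by omega, h3⟩
  have hB : ∀ w ∈ r.support.tail, w ∈ p.support → w = p.getVert j := by
    intro w hw hwp
    rcases hrp w (List.mem_of_mem_tail hw) hwp with rfl | h
    · exact absurd hw (Walk.start_notMem_tail_support hr)
    · exact h
  have hinj := h.getVert_injOn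
  have htail : (((p.take i).append r).append (p.drop j)).support.tail =
      (p.take i).support.tail ++ (r.support.tail ++ (p.drop j).support.tail) := by
    rw [Walk.tail_support_append, Walk.tail_support_append, List.append_assoc]
  have hnd : (((p.take i).append r).append (p.drop j)).support.tail.Nodup := by
    rw [htail, List.nodup_append', List.nodup_append']
    refine ⟨?_, ⟨hr.support_nodup.tail, ?_, ?_⟩, ?_⟩
    · exact (h.isPath_take (by omega)).support_nodup.tail
    · exact (h.isPath_drop (by omega)).support_nodup.tail
    · intro w hw hw'
      obtain ⟨k, h1, h2, rfl⟩ := hC w hw'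
      have h3 := hB _ hw (p.getVert_mem_support k)
      have := hinj ⟨by omega, h2⟩ ⟨by omega, hj⟩ h3
      omega
    · intro w hw hw'
      obtain ⟨k, h1, h2, rfl⟩ := hA w hw
      rcases List.mem_append.1 hw' with hw' | hw'
      · have := hinj ⟨h1, by omega⟩ ⟨by omega, hj⟩ (hB _ hw' (p.getVert_mem_support k))
        omega
      · obtain ⟨l, h3, h4, h5⟩ := hC _ hw'
        have := hinj ⟨by omega, h4⟩ ⟨h1, by omega⟩ h5
        omega
  have hl : p.length < (((p.take i).append r).append (p.drop j)).length := by
    simp only [Walk.length_append, Walk.take_length, Walk.drop_length]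
    omega
  rcases h with ⟨hne, h⟩ | ⟨rfl, h⟩
  · refine Or.inl ⟨hne, Walk.IsPath.mk' ?_⟩
    rw [← Walk.cons_tail_support, List.nodup_cons]
    refine ⟨fun hu => ?_, hnd⟩
    rw [htail, List.mem_append, List.mem_append] at hu
    rcases hu with hu | hu | hu
    · exact Walk.start_notMem_tail_support (h.take i) hu
    · have h0 := hB u hu p.start_mem_support
      have := (h.getVert_eq_start_iff hj).1 h0.symm
      omega
    · obtain ⟨k, h1, h2, h3⟩ := hC u hu
      have := (h.getVert_eq_start_iff h2).1 h3
      omega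
  · refine Or.inr ⟨rfl, ?_⟩
    have h3 := h.three_le_length
    simp only [Walk.length_copy] at h3
    rw [Walk.copy_rfl_rfl, Walk.isCycle_iff_isPath_tail_and_le_length]
    refine ⟨Walk.IsPath.mk' ?_, by omega⟩
    rw [Walk.support_tail_of_not_nil]
    · exact hnd
    · rw [← Walk.length_eq_zero_iff]
      omega

/-- A cycle without its first edge is a path through the same vertices. -/
theorem exists_isPath_support (h : p.IsPathOrCycle) :
    ∃ a b, ∃ q : G.Walk a b, q.IsPath ∧ ∀ w ∈ p.support, w ∈ q.support := by
  have hpos := h.length_pos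
  rcases h with ⟨-, hp⟩ | ⟨rfl, hp⟩
  · exact ⟨u, v, p, hp, fun _ h => h⟩
  · refine ⟨_, _, p.drop 1, Walk.IsCycle.isPath_drop (by simpa using hp) one_pos, fun w hw => ?_⟩
    obtain ⟨k, hk, hk'⟩ := Walk.mem_support_iff_exists_getVert.1 hw
    rcases Nat.eq_zero_or_pos k with rfl | hk0
    · rw [Walk.getVert_zero] at hk
      subst hk
      exact Walk.end_mem_support _
    · refine Walk.mem_support_iff_exists_getVert.2 ⟨k - 1, ?_, by rw [Walk.drop_length]; omega⟩
      rw [Walk.drop_getVert, ← hk]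
      congr 1
      omega

end Walk.IsPathOrCycle

end SimpleGraph

/-! ### Rerouting one edge of a maximum subdivision -/

namespace Graph.SubdivisionModel

open SimpleGraph

variable {α β V : Type*} {R : Graph α β} {G : SimpleGraph V} (M : R.SubdivisionModel G)

theorem isPathOrCycle (e : R.edgeSet) : (M.walk e).IsPathOrCycle := by
  by_cases h : M.src e = M.tgt e
  · exact Or.inr ⟨congrArg M.branch h.symm, M.isCycle e h⟩
  · exact Or.inl ⟨fun h' => h (M.branch_injective h'), M.isPath e h⟩

theorem mem_verts {z : V} : z ∈ M.toSubgraph.verts ↔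
    z ∈ Set.range M.branch ∨ ∃ e, z ∈ (M.walk e).support := Iff.rfl

theorem mem_verts_of_mem_walk {z : V} {e : R.edgeSet} (h : z ∈ (M.walk e).support) :
    z ∈ M.toSubgraph.verts := Or.inr ⟨e, h⟩

theorem getVert_notMem_range_branch {e : R.edgeSet} {k : ℕ} (hk : 0 < k)
    (hk' : k < (M.walk e).length) : (M.walk e).getVert k ∉ Set.range M.branch := by
  rintro ⟨x, hx⟩
  have hmem := (M.walk e).getVert_mem_support k
  rw [← hx] at hmem
  rcases M.branch_mem e x hmem with rfl | rfl
  · have := (M.isPathOrCycle e).eq_of_getVert_eq hk hk' (Nat.zero_le _)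
      (by rw [← hx, Walk.getVert_zero])
    omega
  · have := (M.isPathOrCycle e).eq_of_getVert_eq hk hk' le_rfl
      (by rw [← hx, Walk.getVert_length])
    omega

/-- The realization obtained by replacing the path of one edge. -/
theorem exists_replace (e : R.edgeSet) (w : G.Walk (M.branch (M.src e)) (M.branch (M.tgt e)))
    (hw : w.IsPathOrCycle)
    (hb : ∀ x, M.branch x ∈ w.support → x = M.src e ∨ x = M.tgt e)
    (hi : ∀ f, f ≠ e → ∀ z ∈ w.support, z ∈ (M.walk f).support → z ∈ Set.range M.branch)
    (he : ∀ f, f ≠ e → List.Disjoint w.edges (M.walk f).edges) :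
    ∃ M' : R.SubdivisionModel G, ∀ z, z ∈ M'.toSubgraph.verts ↔
      z ∈ Set.range M.branch ∨ z ∈ w.support ∨ ∃ f, f ≠ e ∧ z ∈ (M.walk f).support := by
  classical
  obtain ⟨W, hWe, hWf⟩ : ∃ W : ∀ f, G.Walk (M.branch (M.src f)) (M.branch (M.tgt f)),
      W e = w ∧ ∀ f, f ≠ e → W f = M.walk f :=
    ⟨Function.update M.walk e w, by simp, fun f hf => by simp [hf]⟩
  refine ⟨⟨M.branch, M.branch_injective, M.src, M.tgt, M.isLink, W, ?_, ?_, ?_, ?_, ?_⟩, ?_⟩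
  · intro f hf
    by_cases hfe : f = e
    · subst hfe
      rw [hWe]
      rcases hw with ⟨-, hw⟩ | ⟨hw, -⟩
      · exact hw
      · exact absurd (M.branch_injective hw).symm hf
    · rw [hWf f hfe]
      exact M.isPath f hf
  · intro f hf
    by_cases hfe : f = e
    · subst hfe
      rw [hWe]
      rcases hw with ⟨h, -⟩ | ⟨_, h⟩
      · exact absurd (congrArg M.branch hf) h
      · exact h
    · rw [hWf f hfe]
      exact M.isCycle f hf
  · intro f x hx
    by_cases hfe : f = e
    · subst hfe
      rw [hWe] at hx
      exact hb x hx
    · rw [hWf f hfe] at hx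
      exact M.branch_mem f x hx
  · intro f g hfg z hf hg
    by_cases hfe : f = e
    · subst hfe
      rw [hWe] at hf
      rw [hWf g hfg.symm] at hg
      exact hi g hfg.symm z hf hg
    · rw [hWf f hfe] at hf
      by_cases hge : g = e
      · subst hge
        rw [hWe] at hg
        exact hi f hfe z hg hf
      · rw [hWf g hge] at hg
        exact M.support_inter f g hfg z hf hg
  · intro f g hfg
    by_cases hfe : f = e
    · subst hfe
      rw [hWe, hWf g hfg.symm]
      exact he g hfg.symm
    · rw [hWf f hfe]
      by_cases hge : g = e
      · subst hge
        rw [hWe]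
        exact (he f hfe).symm
      · rw [hWf g hge]
        exact M.edges_disjoint f g hfg
  · intro z
    rw [mem_verts]
    refine or_congr_right ⟨?_, ?_⟩
    · rintro ⟨f, hf⟩
      by_cases hfe : f = e
      · subst hfe
        exact Or.inl (hWe ▸ hf)
      · exact Or.inr ⟨f, hfe, by rwa [← hWf f hfe]⟩
    · rintro (h | ⟨f, hfe, hf⟩)
      · exact ⟨e, show z ∈ (W e).support from hWe ▸ h⟩
      · exact ⟨f, show z ∈ (W f).support from (hWf f hfe).symm ▸ hf⟩

/-- In a maximum subdivision no segment of the path of an edge can be replaced by a longer path. -/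
theorem length_le_of_isMaxSubdivision [Finite V] (hM : R.IsMaxSubdivision M.toSubgraph)
    {e : R.edgeSet} {i j : ℕ} (hij : i < j) (hj : j ≤ (M.walk e).length)
    {r : G.Walk ((M.walk e).getVert i) ((M.walk e).getVert j)} (hr : r.IsPath)
    (hrM : ∀ w ∈ r.support, w ∈ M.toSubgraph.verts →
      w = (M.walk e).getVert i ∨ w = (M.walk e).getVert j) : r.length ≤ j - i := by
  classical
  by_contra! hlen
  have hgv : ∀ k, (M.walk e).getVert k ∈ (M.walk e).support := (M.walk e).getVert_mem_support
  have hsub : ∀ w ∈ ((((M.walk e).take i).append r).append ((M.walk e).drop j)).support,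
      w ∈ (M.walk e).support ∨ w ∈ r.support := by
    intro w hw
    simp only [Walk.mem_support_append_iff] at hw
    rcases hw with (hw | hw) | hw
    · rw [Walk.support_take] at hw
      exact Or.inl (List.take_subset _ _ hw)
    · exact Or.inr hw
    · rw [Walk.drop_support_eq_support_drop_min] at hw
      exact Or.inl (List.drop_subset _ _ hw)
  have hsub' : ∀ w ∈ ((((M.walk e).take i).append r).append ((M.walk e).drop j)).support,
      w ∈ M.toSubgraph.verts → w ∈ (M.walk e).support := by
    intro w hw hwM
    rcases hsub w hw with h | h
    · exact h
    · rcases hrM w h hwM with rfl | rfl <;> exact hgv _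
  obtain ⟨M', hM'⟩ := M.exists_replace e ((((M.walk e).take i).append r).append ((M.walk e).drop j))
    ((M.isPathOrCycle e).splice hij hj hr
      (fun w hw hwp => hrM w hw (M.mem_verts_of_mem_walk hwp)) hlen)
    (fun x hx => M.branch_mem e x (hsub' _ hx (Or.inl ⟨x, rfl⟩)))
    (fun f hf z hz hzf => M.support_inter f e hf z hzf
      (hsub' z hz (M.mem_verts_of_mem_walk hzf)))
    (fun f hf => by
      intro d hd hdf
      simp only [Walk.edges_append, Walk.edges_take, Walk.edges_drop, List.mem_append] at hd
      rcases hd with (hd | hd) | hd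
      · exact M.edges_disjoint e f hf.symm (List.take_subset _ _ hd) hdf
      -- An edge shared by `r` and another path of the subdivision would have both ends at the ends
      -- of `r`. Then `r` would have length one, whereas it is longer than a segment of at least one
      -- edge.
      · induction d with
        | _ a b =>
        have ha := hrM a (r.fst_mem_support_of_mem_edges hd)
          (M.mem_verts_of_mem_walk ((M.walk f).fst_mem_support_of_mem_edges hdf))
        have hb := hrM b (r.snd_mem_support_of_mem_edges hd)
          (M.mem_verts_of_mem_walk ((M.walk f).snd_mem_support_of_mem_edges hdf))
        have hab : a ≠ b := (r.adj_of_mem_edges hd).ne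
        have hd' : s((M.walk e).getVert i, (M.walk e).getVert j) ∈ r.edges := by
          rcases ha with rfl | rfl <;> rcases hb with rfl | rfl
          · exact absurd rfl hab
          · exact hd
          · rwa [Sym2.eq_swap]
          · exact absurd rfl hab
        have := hr.length_eq_one_of_mem_edges hd'
        omega
      · exact M.edges_disjoint e f hf.symm (List.drop_subset _ _ hd) hdf)
  have hmax := hM.2 _ ⟨M', rfl⟩
  have hne : (M.walk e).getVert i ≠ (M.walk e).getVert j := fun h => by
    have := Walk.isPath_iff_nil.1 ((Walk.isPath_copy r rfl h.symm).2 hr)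
    rw [← Walk.length_eq_zero_iff, Walk.length_copy] at this
    omega
  -- Rerouting loses at most the `j - i - 1` interior vertices of the segment and gains the
  -- `r.length - 1` interior vertices of `r`, none of them in the old subdivision.
  set Iold : Finset V := (Finset.Ioo i j).image (M.walk e).getVert with hIold
  set Inew : Finset V := r.support.toFinset \ {(M.walk e).getVert i, (M.walk e).getVert j} with hInew
  have hIold_card : Iold.card ≤ j - i - 1 := by
    refine Finset.card_image_le.trans ?_
    simp [Nat.card_Ioo]
  have hInew_card : Inew.card = r.length - 1 := by
    rw [hInew, Finset.card_sdiff_of_subset, Finset.card_pair hne,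
      List.toFinset_card_of_nodup hr.support_nodup, Walk.length_support]
    · omega
    · intro w hw
      simp only [Finset.mem_insert, Finset.mem_singleton] at hw
      rcases hw with rfl | rfl <;> simp
  have hsubset : (M.toSubgraph.verts \ (Iold : Set V)) ∪ (Inew : Set V) ⊆ M'.toSubgraph.verts := by
    rintro z (⟨hz, hz'⟩ | hz)
    · rw [hM']
      rcases hz with hz | ⟨f, hf⟩
      · exact Or.inl hz
      · by_cases hfe : f = e
        · subst hfe
          refine Or.inr (Or.inl ?_)
          obtain ⟨k, rfl, hk⟩ := Walk.mem_support_iff_exists_getVert.1 hf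
          simp only [Walk.mem_support_append_iff]
          rcases le_or_gt k i with hki | hki
          · refine Or.inl (Or.inl (Walk.mem_support_iff_exists_getVert.2 ⟨k, ?_, ?_⟩))
            · rw [Walk.take_getVert, min_eq_right hki]
            · rw [Walk.take_length]
              omega
          · rcases lt_or_ge k j with hkj | hkj
            · exact absurd (Finset.mem_coe.2 (Finset.mem_image_of_mem _
                (Finset.mem_Ioo.2 ⟨hki, hkj⟩))) hz'
            · refine Or.inr (Walk.mem_support_iff_exists_getVert.2 ⟨k - j, ?_, ?_⟩)
              · rw [Walk.drop_getVert]
                congr 1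
                omega
              · rw [Walk.drop_length]
                omega
        · exact Or.inr (Or.inr ⟨f, hfe, hf⟩)
    · rw [hM']
      refine Or.inr (Or.inl ?_)
      have : z ∈ r.support := by
        have := Finset.mem_coe.1 hz
        simp only [hInew, Finset.mem_sdiff, List.mem_toFinset] at this
        exact this.1
      simp [Walk.mem_support_append_iff, this]
  have hdisj : Disjoint (M.toSubgraph.verts \ (Iold : Set V)) (Inew : Set V) := by
    rw [Set.disjoint_left]
    rintro z ⟨hz, -⟩ hz'
    have := Finset.mem_coe.1 hz'
    simp only [hInew, Finset.mem_sdiff, List.mem_toFinset, Finset.mem_insert,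
      Finset.mem_singleton] at this
    exact this.2 (hrM z this.1 hz)
  have h1 := Set.ncard_le_ncard hsubset (Set.toFinite _)
  rw [Set.ncard_union_eq hdisj (Set.toFinite _) (Set.toFinite _), Set.ncard_coe_finset,
    hInew_card] at h1
  have h2 := Set.le_ncard_sdiff (Iold : Set V) M.toSubgraph.verts
  rw [Set.ncard_coe_finset] at h2
  omega

end Graph.SubdivisionModel

/-! ### Cutting a maximum subdivision into chunks -/

namespace SimpleGraph

/-- The vertices of `F` can be coloured with `K` colours such that any two vertices of the same
colour are joined by a path inside `F` of length less than `ℓ` that is at least as long as every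
path between them with interior outside `F`. -/
def HasChunks {V : Type*} (G : SimpleGraph V) (F : Set V) (ℓ K : ℕ) : Prop :=
  ∃ χ : V → Fin K, ∀ x ∈ F, ∀ y ∈ F, x ≠ y → χ x = χ y →
    ∃ q : G.Walk x y, q.IsPath ∧ (∀ v ∈ q.support, v ∈ F) ∧ q.length < ℓ ∧
      ∀ p : G.Walk x y, p.IsPath → (∀ v ∈ p.support, v ∈ F → v = x ∨ v = y) →
        p.length ≤ q.length

end SimpleGraph

namespace Graph.SubdivisionModel

open SimpleGraph

variable {α β V : Type*} {R : Graph α β} {G : SimpleGraph V} (M : R.SubdivisionModel G)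

theorem exists_getVert_eq (hR : R.NoIsolatedVertex) {z : V} (hz : z ∈ M.toSubgraph.verts) :
    ∃ e k, k ≤ (M.walk e).length ∧ (M.walk e).getVert k = z := by
  rcases hz with ⟨x, rfl⟩ | ⟨e, he⟩
  · obtain ⟨e, he⟩ := hR x.1 x.2
    have hl := M.isLink ⟨e, he.edge_mem⟩
    rcases he.eq_or_eq_of_isLink hl with h | h
    · refine ⟨⟨e, he.edge_mem⟩, 0, Nat.zero_le _, ?_⟩
      exact (Walk.getVert_zero _).trans (congrArg M.branch (Subtype.ext h).symm)
    · refine ⟨⟨e, he.edge_mem⟩, _, le_rfl, ?_⟩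
      exact (Walk.getVert_length _).trans (congrArg M.branch (Subtype.ext h).symm)
  · obtain ⟨k, hk, hk'⟩ := Walk.mem_support_iff_exists_getVert.1 he
    exact ⟨e, k, hk', hk⟩

/-- A path of length `l` has `l - 1` interior vertices, and those of all edges together are
distinct. -/
theorem sum_length_le [Fintype V] [Fintype R.edgeSet] :
    ∑ e, (M.walk e).length ≤ Fintype.card V + Fintype.card R.edgeSet := by
  have hinj : Function.Injective
      (fun x : Σ e : R.edgeSet, Fin ((M.walk e).length - 1) => (M.walk x.1).getVert (x.2 + 1)) := by
    rintro ⟨e, k⟩ ⟨f, l⟩ h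
    have hk := k.2
    have hl := l.2
    simp only at h
    by_cases hef : e = f
    · subst hef
      have := (M.isPathOrCycle e).eq_of_getVert_eq (by omega) (by omega) (by omega) h
      have : k = l := Fin.ext (by omega)
      rw [this]
    · refine absurd (M.support_inter e f hef _ ((M.walk e).getVert_mem_support _)
        (by rw [h]; exact (M.walk f).getVert_mem_support _))
        (M.getVert_notMem_range_branch (by omega) (by omega))
  have hc := Fintype.card_le_of_injective _ hinj
  rw [Fintype.card_sigma] at hc
  simp only [Fintype.card_fin] at hc
  calc ∑ e, (M.walk e).length ≤ ∑ e, (((M.walk e).length - 1) + 1) :=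
        Finset.sum_le_sum fun e _ => by omega
    _ = ∑ e, ((M.walk e).length - 1) + Fintype.card R.edgeSet := by
        rw [Finset.sum_add_distrib]
        simp
    _ ≤ _ := by omega

/-- A vertex at position `k` on the path of `e` is coloured by `e` and `k / ℓ`. Two vertices in one
block bound a segment of length less than `ℓ`, which cannot be replaced by a longer path. The last,
incomplete blocks account for the summand `card R.edgeSet`. -/
theorem hasChunks [Fintype V] [Fintype R.edgeSet] [Nonempty R.edgeSet]
    (hR : R.NoIsolatedVertex) (hM : R.IsMaxSubdivision M.toSubgraph) {ℓ : ℕ} (hℓ : 0 < ℓ) :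
    G.HasChunks M.toSubgraph.verts ℓ
      ((Fintype.card V + Fintype.card R.edgeSet) / ℓ + Fintype.card R.edgeSet) := by
  classical
  let T := Σ e : R.edgeSet, Fin ((M.walk e).length / ℓ + 1)
  have hT : Fintype.card T ≤
      (Fintype.card V + Fintype.card R.edgeSet) / ℓ + Fintype.card R.edgeSet := by
    simp only [T, Fintype.card_sigma, Fintype.card_fin, Finset.sum_add_distrib, Finset.sum_const,
      smul_eq_mul, mul_one, Finset.card_univ]
    gcongr
    rw [Nat.le_div_iff_mul_le hℓ, Finset.sum_mul]
    exact (Finset.sum_le_sum fun e _ => Nat.div_mul_le_self _ _).trans M.sum_length_le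
  obtain ⟨ι⟩ : Nonempty (T ↪ Fin ((Fintype.card V + Fintype.card R.edgeSet) / ℓ +
      Fintype.card R.edgeSet)) := Function.Embedding.nonempty_of_card_le (by simpa using hT)
  have hpos : ∀ z, ∃ t : T, z ∈ M.toSubgraph.verts →
      ∃ k, k ≤ (M.walk t.1).length ∧ (M.walk t.1).getVert k = z ∧ k / ℓ = t.2 := by
    intro z
    by_cases hz : z ∈ M.toSubgraph.verts
    · obtain ⟨e, k, hk, hkz⟩ := M.exists_getVert_eq hR hz
      exact ⟨⟨e, ⟨k / ℓ, Nat.lt_succ_of_le (Nat.div_le_div_right hk)⟩⟩,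
        fun _ => ⟨k, hk, hkz, rfl⟩⟩
    · exact ⟨⟨Classical.arbitrary _, 0⟩, fun h => absurd h hz⟩
  choose t ht using hpos
  have main : ∀ (e : R.edgeSet) (i j : ℕ), i < j → j ≤ (M.walk e).length → i / ℓ = j / ℓ →
      (M.walk e).getVert i ≠ (M.walk e).getVert j →
      ∃ q : G.Walk ((M.walk e).getVert i) ((M.walk e).getVert j),
        q.IsPath ∧ (∀ v ∈ q.support, v ∈ M.toSubgraph.verts) ∧ q.length < ℓ ∧
        ∀ p : G.Walk ((M.walk e).getVert i) ((M.walk e).getVert j), p.IsPath →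
          (∀ v ∈ p.support, v ∈ M.toSubgraph.verts → v = (M.walk e).getVert i ∨
            v = (M.walk e).getVert j) → p.length ≤ q.length := by
    intro e i j hij hj hd hne
    obtain ⟨q, hq, hql, hqs⟩ := (M.isPathOrCycle e).exists_segment hij hj hne
    refine ⟨q, hq, fun v hv => M.mem_verts_of_mem_walk (hqs hv), ?_, fun p hp hpM => ?_⟩
    · have h1 := Nat.div_add_mod i ℓ
      have h2 := Nat.div_add_mod j ℓ
      have h3 := Nat.mod_lt j hℓ
      rw [hd] at h1
      omega
    · rw [hql]
      exact M.length_le_of_isMaxSubdivision hM hij hj hp hpM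
  refine ⟨fun z => ι (t z), fun x hx y hy hxy hχ => ?_⟩
  have htxy := ι.injective hχ
  obtain ⟨i, hi, hix, hi'⟩ := ht x hx
  obtain ⟨j, hj, hjy, hj'⟩ := ht y hy
  rw [← htxy] at hj hjy hj'
  generalize t x = s at hi hix hi' hj hjy hj'
  subst hix hjy
  have hd : i / ℓ = j / ℓ := by rw [hi', hj']
  rcases lt_trichotomy i j with hij | rfl | hij
  · exact main s.1 i j hij hj hd hxy
  · exact absurd rfl hxy
  · obtain ⟨q, hq, hqM, hql, hmax⟩ := main s.1 j i hij hi hd.symm hxy.symm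
    refine ⟨q.reverse, hq.reverse, by simpa using hqM, by simpa using hql, fun p hp hpM => ?_⟩
    simpa using hmax p.reverse hp.reverse (by
      intro v hv hvM
      exact (hpM v (by simpa using hv) hvM).symm)

theorem verts_subset_iUnion_path (hR : R.NoIsolatedVertex) :
    ∃ (a b : R.edgeSet → V) (q : ∀ e, G.Walk (a e) (b e)), (∀ e, (q e).IsPath) ∧
      ∀ z ∈ M.toSubgraph.verts, ∃ e, z ∈ (q e).support := by
  choose a b q hq hs using fun e => (M.isPathOrCycle e).exists_isPath_support
  refine ⟨a, b, q, hq, fun z hz => ?_⟩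
  obtain ⟨e, k, -, rfl⟩ := M.exists_getVert_eq hR hz
  exact ⟨e, hs e _ ((M.walk e).getVert_mem_support k)⟩

theorem reachAvoiding_of_isConnectedMultigraph (hR : R.IsConnectedMultigraph)
    (hR' : R.NoIsolatedVertex) {Z : Set V} (hZ : Disjoint Z M.toSubgraph.verts) {x y : V}
    (hx : x ∈ M.toSubgraph.verts) (hy : y ∈ M.toSubgraph.verts) : G.ReachAvoiding Z x y := by
  classical
  rw [Set.disjoint_left] at hZ
  have hwalk : ∀ e, ∀ z ∈ (M.walk e).support, G.ReachAvoiding Z (M.branch (M.src e)) z :=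
    fun e z hz => ⟨(M.walk e).takeUntil z hz, fun v hv hvZ =>
      hZ hvZ (M.mem_verts_of_mem_walk ((M.walk e).support_takeUntil_subset_support hz hv))⟩
  have hlink : ∀ (u v : R.vertexSet) (e : R.edgeSet), R.IsLink e.1 u.1 v.1 →
      G.ReachAvoiding Z (M.branch u) (M.branch v) := by
    intro u v e h
    have h1 := hwalk e _ (M.walk e).end_mem_support
    rcases h.eq_and_eq_or_eq_and_eq (M.isLink e) with ⟨h2, h3⟩ | ⟨h2, h3⟩
    · rw [Subtype.ext h2, Subtype.ext h3]
      exact h1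
    · rw [Subtype.ext h2, Subtype.ext h3]
      exact h1.symm
  have hbranch : ∀ u v : R.vertexSet, G.ReachAvoiding Z (M.branch u) (M.branch v) := by
    intro u v
    have hr := hR.2 u.1 u.2 v.1 v.2
    have : ∀ w : α, Relation.ReflTransGen R.Adj u.1 w → ∀ hw : w ∈ R.vertexSet,
        G.ReachAvoiding Z (M.branch u) (M.branch ⟨w, hw⟩) := by
      intro w h
      induction h with
      | refl => exact fun _ => .refl fun h => hZ h (Or.inl ⟨_, rfl⟩)
      | @tail a b _ hab ih =>
        intro hw
        obtain ⟨e, he⟩ := hab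
        exact (ih he.left_mem).trans (hlink ⟨a, he.left_mem⟩ ⟨b, hw⟩ ⟨e, he.edge_mem⟩ he)
    exact this v.1 hr v.2
  have hall : ∀ z ∈ M.toSubgraph.verts, ∃ u, G.ReachAvoiding Z (M.branch u) z := by
    intro z hz
    obtain ⟨e, k, -, rfl⟩ := M.exists_getVert_eq hR' hz
    exact ⟨_, hwalk e _ ((M.walk e).getVert_mem_support k)⟩
  obtain ⟨u, hu⟩ := hall x hx
  obtain ⟨v, hv⟩ := hall y hy
  exact (hu.symm.trans (hbranch u v)).trans hv

end Graph.SubdivisionModel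

/-! ### Vertex connectivity and the size of maximum subdivisions -/

namespace SimpleGraph

variable {V : Type*} {G : SimpleGraph V}

theorem IsVertexConnected.reachAvoiding [Fintype V] {k : ℕ} (h : G.IsVertexConnected k)
    {S : Finset V} (hS : S.card < k) {x y : V} (hx : x ∉ S) (hy : y ∉ S) :
    G.ReachAvoiding S x y := by
  obtain ⟨p⟩ := (h.2 S hS).preconnected ⟨x, hx⟩ ⟨y, hy⟩
  have key : ∀ {a b : {z | z ∉ S}} (_ : (G.induce {z | z ∉ S}).Walk a b),
      G.ReachAvoiding S a.1 b.1 := by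
    intro a b q
    induction q with
    | @nil a => exact .refl (show a.1 ∉ (S : Set V) from a.2)
    | @cons a b _ hadj _ ih =>
      exact (ReachAvoiding.of_adj (show G.Adj a.1 b.1 from hadj)
        (show a.1 ∉ (S : Set V) from a.2) (show b.1 ∉ (S : Set V) from b.2)).trans ih
  exact key p

/-- A vertex of a set `S` of fewer than `k` vertices of a `k`-connected graph has a neighbour
outside `S`. -/
theorem IsVertexConnected.exists_adj_notMem [Fintype V] {k : ℕ} (h : G.IsVertexConnected k)
    {S : Finset V} (hS : S.card < k) {x : V} (hx : x ∈ S) : ∃ y ∉ S, G.Adj x y := by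
  classical
  obtain ⟨z, hz⟩ : ∃ z, z ∉ S := by
    by_contra! hall
    have := h.1
    rw [← Finset.card_univ, ← (Finset.eq_univ_iff_forall.2 hall)] at this
    omega
  obtain ⟨p, hp⟩ := h.reachAvoiding (S := S.erase x)
    ((Finset.card_le_card (Finset.erase_subset _ _)).trans_lt hS) (Finset.notMem_erase x S)
    (fun h => hz (Finset.mem_of_mem_erase h))
  cases p with
  | nil => exact absurd hx hz
  | @cons _ y _ hadj p =>
    refine ⟨y, fun hy => hp y (by simp) ?_, hadj⟩
    simp [hy, hadj.ne']

end SimpleGraph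

namespace Graph.SubdivisionModel

open SimpleGraph

variable {α β V : Type*} {R : Graph α β} {G : SimpleGraph V} (M : R.SubdivisionModel G)

/-- With fewer than `k` vertices, both ends of the first edge of some path have neighbours outside
the subdivision, and these are joined outside it. That edge could then be replaced by a path of
length at least two. -/
theorem le_ncard_verts [Fintype V] [Nonempty R.edgeSet] (hM : R.IsMaxSubdivision M.toSubgraph)
    {k : ℕ} (hG : G.IsVertexConnected k) : k ≤ M.toSubgraph.verts.ncard := by
  classical
  by_contra! hlt
  obtain ⟨e⟩ := ‹Nonempty R.edgeSet›
  have hpos := (M.isPathOrCycle e).length_pos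
  set S : Finset V := M.toSubgraph.verts.toFinset with hS
  have hSm : ∀ v, v ∈ S ↔ v ∈ M.toSubgraph.verts := fun v => Set.mem_toFinset
  have hcard : S.card < k := by
    rwa [hS, ← Set.ncard_eq_toFinset_card']
  have hmem : ∀ i, (M.walk e).getVert i ∈ S := fun i =>
    (hSm _).2 (M.mem_verts_of_mem_walk ((M.walk e).getVert_mem_support i))
  have hadj : G.Adj ((M.walk e).getVert 0) ((M.walk e).getVert 1) :=
    (M.walk e).adj_getVert_succ hpos
  obtain ⟨x, hx, hax⟩ := hG.exists_adj_notMem hcard (hmem 0)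
  obtain ⟨y, hy, hby⟩ := hG.exists_adj_notMem hcard (hmem 1)
  obtain ⟨p, hp⟩ := hG.reachAvoiding hcard hx hy
  have hq : ∀ v ∈ p.bypass.support, v ∉ S := fun v hv => hp v (p.support_bypass_subset_support hv)
  have hpath : (p.bypass.concat hby.symm).IsPath :=
    (p.bypass_isPath).concat (fun h => hq _ h (hmem 1)) _
  have hpath' : (Walk.cons hax (p.bypass.concat hby.symm)).IsPath := by
    refine hpath.cons fun h => ?_
    rw [Walk.support_concat, List.mem_append, List.mem_singleton] at h
    rcases h with h | h
    · exact hq _ h (hmem 0)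
    · exact hadj.ne h
  have := M.length_le_of_isMaxSubdivision hM (i := 0) (j := 1) one_pos hpos hpath' (by
    intro w hw hwM
    rw [Walk.support_cons, Walk.support_concat, List.mem_cons, List.mem_append,
      List.mem_singleton] at hw
    rcases hw with h | h | h
    · exact Or.inl h
    · exact absurd ((hSm _).2 hwM) (hq _ h)
    · exact Or.inr h)
  simp at this

end Graph.SubdivisionModel

namespace SimpleGraph

variable {V : Type*} {G : SimpleGraph V}

/-! ### Detours -/

theorem Walk.IsPath.append_of_forall {u v w : V} {p : G.Walk u v} {q : G.Walk v w} (hp : p.IsPath)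
    (hq : q.IsPath) (h : ∀ z ∈ p.support, z ∈ q.support → z = v) : (p.append q).IsPath := by
  refine Walk.IsPath.mk' ?_
  rw [Walk.support_append, List.nodup_append']
  refine ⟨hp.support_nodup, hq.support_nodup.tail, fun z hz hz' => ?_⟩
  obtain rfl := h z hz (List.mem_of_mem_tail hz')
  exact Walk.start_notMem_tail_support hq hz'

theorem Linkage.length_pos {A B : Set V} {ι : Type*} (L : G.Linkage A B ι) (h : Disjoint A B)
    (i : ι) : 0 < (L.path i).length := by
  by_contra h0
  have := Walk.eq_of_length_eq_zero (p := L.path i) (by omega)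
  exact Set.disjoint_left.1 h (L.a_mem i) (this ▸ L.b_mem i)

theorem Linkage.exists_detour {A B : Set V} {ι : Type*} (L : G.Linkage A B ι) (h : Disjoint A B)
    {i j : ι} (hij : i ≠ j) {q : G.Walk (L.a i) (L.a j)} (hq : q.IsPath)
    (hqA : ∀ v ∈ q.support, v ∈ A) :
    ∃ p : G.Walk (L.b i) (L.b j), p.IsPath ∧ q.length + 2 ≤ p.length ∧
      (∀ v ∈ p.support, v ∈ B → v = L.b i ∨ v = L.b j) ∧
      ∀ v ∈ p.support, v ∈ (L.path i).support ∨ v ∈ q.support ∨ v ∈ (L.path j).support := by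
  have hsup : ∀ v ∈ ((L.path i).reverse.append (q.append (L.path j))).support,
      v ∈ (L.path i).support ∨ v ∈ q.support ∨ v ∈ (L.path j).support := by
    intro v hv
    simpa only [Walk.mem_support_append_iff, Walk.support_reverse, List.mem_reverse] using hv
  refine ⟨(L.path i).reverse.append (q.append (L.path j)), ?_, ?_, ?_, hsup⟩
  · refine (L.isPath i).reverse.append_of_forall
      (hq.append_of_forall (L.isPath j) fun z hz hz' => L.eq_a j z hz' (hqA z hz)) ?_
    intro z hz hz'
    rw [Walk.support_reverse, List.mem_reverse] at hz
    rcases (Walk.mem_support_append_iff _ _).1 hz' with hz' | hz'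
    · exact L.eq_a i z hz (hqA z hz')
    · exact absurd (L.disj i j z hz hz') hij
  · have h1 := L.length_pos h i
    have h2 := L.length_pos h j
    simp only [Walk.length_append, Walk.length_reverse]
    omega
  · intro v hv hvB
    rcases hsup v hv with hv | hv | hv
    · exact Or.inl (L.eq_b i v hv hvB)
    · exact absurd hvB (Set.disjoint_left.1 h (hqA v hv))
    · exact Or.inr (L.eq_b j v hv hvB)

theorem HasChunks.not_disjoint {F₁ F₂ : Set V} {ℓ m : ℕ} (h₁ : G.HasChunks F₁ ℓ m)
    (h₂ : G.HasChunks F₂ ℓ m) (L : G.Linkage F₁ F₂ (Fin (m ^ 2 + 1))) : ¬ Disjoint F₁ F₂ := by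
  intro hd
  obtain ⟨χ₁, h₁⟩ := h₁
  obtain ⟨χ₂, h₂⟩ := h₂
  obtain ⟨i, j, hij, hχ⟩ := Fintype.exists_ne_map_eq_of_card_lt
    (fun i => (χ₁ (L.a i), χ₂ (L.b i))) (by simp [sq])
  simp only [Prod.mk.injEq] at hχ
  obtain ⟨q₁, hq₁, hq₁F, -, hmax₁⟩ := h₁ _ (L.a_mem i) _ (L.a_mem j)
    (fun h => hij (L.a_injective h)) hχ.1
  obtain ⟨q₂, hq₂, hq₂F, -, hmax₂⟩ := h₂ _ (L.b_mem i) _ (L.b_mem j)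
    (fun h => hij (L.b_injective h)) hχ.2
  obtain ⟨p₁, hp₁, hl₁, hpF₁, -⟩ := L.exists_detour hd hij hq₁ hq₁F
  obtain ⟨p₂, hp₂, hl₂, hpF₂, -⟩ := L.reverse.exists_detour hd.symm hij (q := q₂) hq₂ hq₂F
  -- Each detour gains two edges because the linking paths are nontrivial, the two sets being
  -- disjoint.
  have h12 : q₁.length + 2 ≤ q₂.length := hl₁.trans (hmax₂ p₁ hp₁ hpF₁)
  have h21 : q₂.length + 2 ≤ q₁.length := hl₂.trans (hmax₁ p₂ hp₂ hpF₂)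
  omega

/-! ### Separating sets from a family of connected, pairwise intersecting sets -/

/-- `Z` separates `X` from every member of `𝓕` that avoids `Z`. -/
def SeparatesFromFamily (G : SimpleGraph V) (𝓕 : Set (Set V)) (Z : Finset V) (X : Set V) : Prop :=
  ∀ F ∈ 𝓕, Disjoint (Z : Set V) F → ∀ x ∈ X, ∀ f ∈ F, ¬ G.ReachAvoiding Z x f

/-- The least size of a set that separates `X` from every member of `𝓕` that it avoids. -/
noncomputable def cutNumber (G : SimpleGraph V) (𝓕 : Set (Set V)) (X : Set V) : ℕ :=
  sInf {k | ∃ Z : Finset V, Z.card = k ∧ G.SeparatesFromFamily 𝓕 Z X}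

section CutNumber

variable {𝓕 : Set (Set V)} {X Y : Set V} {Z : Finset V} {t : ℕ}

theorem cutNumber_le (h : G.SeparatesFromFamily 𝓕 Z X) : G.cutNumber 𝓕 X ≤ Z.card :=
  Nat.sInf_le ⟨Z, rfl, h⟩

theorem exists_disjoint_of_card_lt
    (ht : ∀ S : Finset V, (∀ F ∈ 𝓕, ∃ z ∈ S, z ∈ F) → t ≤ S.card) (hZ : Z.card < t) :
    ∃ F ∈ 𝓕, Disjoint (Z : Set V) F := by
  by_contra! h
  refine absurd (ht Z fun F hF => ?_) (by omega)
  obtain ⟨z, hz, hz'⟩ := Set.not_disjoint_iff.1 (h F hF)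
  exact ⟨z, hz, hz'⟩

theorem cutNumber_le_card (S : Finset V) : G.cutNumber 𝓕 S ≤ S.card :=
  cutNumber_le fun _ _ _ _ hx _ _ h => h.left_notMem hx

variable [Fintype V]

theorem exists_card_eq_cutNumber (G : SimpleGraph V) (𝓕 : Set (Set V)) (X : Set V) :
    ∃ Z : Finset V, Z.card = G.cutNumber 𝓕 X ∧ G.SeparatesFromFamily 𝓕 Z X :=
  Nat.sInf_mem (s := {k | ∃ Z : Finset V, Z.card = k ∧ G.SeparatesFromFamily 𝓕 Z X})
    ⟨_, Finset.univ, rfl, fun _ _ _ _ _ _ _ h => h.left_notMem (by simp)⟩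

theorem cutNumber_mono (h : X ⊆ Y) : G.cutNumber 𝓕 X ≤ G.cutNumber 𝓕 Y := by
  obtain ⟨Z, hZ, hsep⟩ := exists_card_eq_cutNumber G 𝓕 Y
  exact hZ ▸ cutNumber_le fun F hF hd x hx => hsep F hF hd x (h hx)

theorem cutNumber_union_le : G.cutNumber 𝓕 (X ∪ Y) ≤ G.cutNumber 𝓕 X + G.cutNumber 𝓕 Y := by
  classical
  obtain ⟨Z, hZ, hsep⟩ := exists_card_eq_cutNumber G 𝓕 X
  obtain ⟨Z', hZ', hsep'⟩ := exists_card_eq_cutNumber G 𝓕 Y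
  rw [← hZ, ← hZ']
  refine (cutNumber_le (Z := Z ∪ Z') ?_).trans (Finset.card_union_le _ _)
  intro F hF hd x hx f hf hr
  rw [Finset.coe_union] at hd hr
  rw [Set.disjoint_union_left] at hd
  rcases hx with hx | hx
  · exact hsep F hF hd.1 x hx f hf (hr.mono Set.subset_union_left)
  · exact hsep' F hF hd.2 x hx f hf (hr.mono Set.subset_union_right)

theorem cutNumber_iUnion_le {ι : Type*} (s : Finset ι) (X : ι → Set V) :
    G.cutNumber 𝓕 (⋃ i ∈ s, X i) ≤ ∑ i ∈ s, G.cutNumber 𝓕 (X i) := by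
  classical
  induction s using Finset.induction_on with
  | empty => simpa using cutNumber_le_card (G := G) (𝓕 := 𝓕) ∅
  | insert a s ha ih =>
    rw [Finset.set_biUnion_insert, Finset.sum_insert ha]
    exact cutNumber_union_le.trans (by gcongr)

theorem exists_disjoint_of_cutNumber_lt
    (ht : ∀ S : Finset V, (∀ F ∈ 𝓕, ∃ z ∈ S, z ∈ F) → t ≤ S.card) (hX : G.cutNumber 𝓕 X < t) :
    ∃ F ∈ 𝓕, Disjoint X F := by
  obtain ⟨Z, hZ, hsep⟩ := exists_card_eq_cutNumber G 𝓕 X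
  obtain ⟨F, hF, hd⟩ := exists_disjoint_of_card_lt ht (hZ ▸ hX)
  exact ⟨F, hF, Set.disjoint_left.2 fun x hx hxF =>
    hsep F hF hd x hx x hxF (.refl (Set.disjoint_right.1 hd hxF))⟩

/-- Otherwise some member of the family would be disjoint from `F`. -/
theorem le_cutNumber_of_mem
    (ht : ∀ S : Finset V, (∀ F ∈ 𝓕, ∃ z ∈ S, z ∈ F) → t ≤ S.card)
    (hint : ∀ F ∈ 𝓕, ∀ F' ∈ 𝓕, (F ∩ F').Nonempty) {F : Set V} (hF : F ∈ 𝓕) :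
    t ≤ G.cutNumber 𝓕 F := by
  by_contra! h
  obtain ⟨F', hF', hd⟩ := exists_disjoint_of_cutNumber_lt ht h
  exact (hint F hF F' hF').not_disjoint hd

/-- Separating `X` from one member `F` separates it from every member `F'` that avoids the
separator, as `F'` is connected and meets `F`. So Menger's theorem applies with the cut number. -/
theorem exists_linkage_of_le_cutNumber
    (hconn : ∀ F ∈ 𝓕, ∀ Z : Set V, Disjoint Z F → ∀ x ∈ F, ∀ y ∈ F, G.ReachAvoiding Z x y)
    (hint : ∀ F ∈ 𝓕, ∀ F' ∈ 𝓕, (F ∩ F').Nonempty) {F : Set V} (hF : F ∈ 𝓕) {k : ℕ}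
    (hk : k ≤ G.cutNumber 𝓕 X) : Nonempty (G.Linkage X F (Fin k)) := by
  refine exists_linkage G X F k fun Z hZ => hk.trans (cutNumber_le ?_)
  intro F' hF' hd x hx f hf hr
  obtain ⟨z, hz, hz'⟩ := hint F hF F' hF'
  exact hZ x hx z hz (hr.trans (hconn F' hF' Z hd f hf z hz'))

/-- A smallest set that separates `W` from the family is itself not separated from the family by
fewer vertices. -/
theorem le_cutNumber_of_separatesFromFamily
    (ht : ∀ S : Finset V, (∀ F ∈ 𝓕, ∃ z ∈ S, z ∈ F) → t ≤ S.card)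
    (hconn : ∀ F ∈ 𝓕, ∀ Z : Set V, Disjoint Z F → ∀ x ∈ F, ∀ y ∈ F, G.ReachAvoiding Z x y)
    (hint : ∀ F ∈ 𝓕, ∀ F' ∈ 𝓕, (F ∩ F').Nonempty) {W : Set V}
    (hZ : Z.card = G.cutNumber 𝓕 W) (hsep : G.SeparatesFromFamily 𝓕 Z W)
    (h2 : 2 * Z.card ≤ t) : Z.card ≤ G.cutNumber 𝓕 Z := by
  classical
  by_contra! hlt
  obtain ⟨Y, hY, hYsep⟩ := exists_card_eq_cutNumber G 𝓕 (Z : Set V)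
  rw [← hY] at hlt
  have hcard : (Y ∪ Z).card < t := (Finset.card_union_le _ _).trans_lt (by omega)
  -- `Y` would separate `W` too: a walk from `W` off `Y` extends within `F` to this `F'`, and it
  -- contradicts the choice of `Y` if it meets `Z`, and that of `Z` if not.
  obtain ⟨F', hF', hd'⟩ := exists_disjoint_of_card_lt ht hcard
  rw [Finset.coe_union, Set.disjoint_union_left] at hd'
  refine absurd (hZ ▸ cutNumber_le (Z := Y) (X := W) (G := G) (𝓕 := 𝓕) ?_) (not_le.2 hlt)
  intro F hF hd w hw f hf hr
  obtain ⟨x, hx, hx'⟩ := hint F hF F' hF'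
  obtain ⟨p, hp⟩ := hr.trans (hconn F hF Y hd f hf x hx)
  by_cases hpZ : ∃ z ∈ p.support, z ∈ Z
  · obtain ⟨z, hz, hzZ⟩ := hpZ
    exact hYsep F' hF' hd'.1 z hzZ x hx' ⟨p.dropUntil z hz, fun v hv =>
      hp v (p.support_dropUntil_subset_support hz hv)⟩
  · push Not at hpZ
    exact hsep F' hF' hd'.2 w hw x hx' ⟨p, fun v hv => hpZ v hv⟩

/-- Linkages from `W` to the members of the family can be chosen such that no part of the set of
their first vertices is separated from the family by fewer vertices than it has. -/
theorem exists_linkage_forall_card_le_cutNumber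
    (ht : ∀ S : Finset V, (∀ F ∈ 𝓕, ∃ z ∈ S, z ∈ F) → t ≤ S.card) (ht0 : 0 < t)
    (hconn : ∀ F ∈ 𝓕, ∀ Z : Set V, Disjoint Z F → ∀ x ∈ F, ∀ y ∈ F, G.ReachAvoiding Z x y)
    (hint : ∀ F ∈ 𝓕, ∀ F' ∈ 𝓕, (F ∩ F').Nonempty) {W : Set V} {s : ℕ}
    (hs : G.cutNumber 𝓕 W = s) (h2 : 2 * s ≤ t) :
    ∃ F ∈ 𝓕, Disjoint W F ∧ ∃ L : G.Linkage W F (Fin s),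
      ∀ I : Finset (Fin s), I.card ≤ G.cutNumber 𝓕 (L.a '' I) := by
  classical
  obtain ⟨Z, hZ, hsep⟩ := exists_card_eq_cutNumber G 𝓕 W
  have hZs : Z.card = s := hZ.trans hs
  obtain ⟨F₁, hF₁, hd₁⟩ := exists_disjoint_of_card_lt (Z := Z) ht (by omega)
  obtain ⟨L⟩ := exists_linkage_of_le_cutNumber (X := W) hconn hint hF₁ hs.ge
  have hWF : Disjoint W F₁ := Set.disjoint_left.2 fun x hx hxF =>
    hsep F₁ hF₁ hd₁ x hx x hxF (.refl (Set.disjoint_right.1 hd₁ hxF))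
  -- By subadditivity, leaving out `s - I.card` first vertices lowers the cut number by at most that
  -- many.
  suffices hall : s ≤ G.cutNumber 𝓕 (Set.range L.a) by
    refine ⟨F₁, hF₁, hWF, L, fun I => ?_⟩
    have h1 : Set.range L.a = L.a '' (I : Set (Fin s)) ∪ ((Iᶜ.image L.a : Finset V) : Set V) := by
      rw [Finset.coe_image, ← Set.image_union, Finset.coe_compl, Set.union_compl_self,
        Set.image_univ]
    have h3 : (Iᶜ.image L.a).card ≤ s - I.card := by
      refine Finset.card_image_le.trans ?_
      rw [Finset.card_compl, Fintype.card_fin]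
    have h4 := cutNumber_le_card (G := G) (𝓕 := 𝓕) (Iᶜ.image L.a)
    have h5 := cutNumber_union_le (G := G) (𝓕 := 𝓕) (X := L.a '' (I : Set (Fin s)))
      (Y := ((Iᶜ.image L.a : Finset V) : Set V))
    rw [← h1] at h5
    have h6 : I.card ≤ s := by simpa using I.card_le_univ
    omega
  by_contra! hlt
  obtain ⟨Y, hY, hYsep⟩ := exists_card_eq_cutNumber G 𝓕 (Set.range L.a)
  rw [← hY] at hlt
  obtain ⟨F, hF, hd⟩ := exists_disjoint_of_card_lt (Z := Y ∪ Z) ht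
    ((Finset.card_union_le _ _).trans_lt (by omega))
  rw [Finset.coe_union, Set.disjoint_union_left] at hd
  have hZcut : s ≤ G.cutNumber 𝓕 Z := hZs ▸
    le_cutNumber_of_separatesFromFamily ht hconn hint hZ hsep (by omega)
  obtain ⟨T⟩ := exists_linkage_of_le_cutNumber hconn hint hF hZcut
  have hTsurj : ∀ z ∈ Z, ∃ j, T.a j = z := by
    have himg : Finset.univ.image T.a = Z := by
      refine Finset.eq_of_subset_of_card_le (fun v hv => ?_) ?_
      · obtain ⟨j, -, rfl⟩ := Finset.mem_image.1 hv
        exact T.a_mem j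
      · rw [Finset.card_image_of_injective _ T.a_injective, Finset.card_univ, Fintype.card_fin,
          hZs]
    intro z hz
    rw [← himg] at hz
    simpa using hz
  have hhit : ∀ i, ∃ j, T.a j ∈ (L.path i).support := by
    intro i
    by_contra! hcon
    refine hsep F₁ hF₁ hd₁ _ (L.a_mem i) _ (L.b_mem i) ⟨L.path i, fun v hv hvZ => ?_⟩
    obtain ⟨j, rfl⟩ := hTsurj v hvZ
    exact hcon j hv
  choose σ hσ using hhit
  have hσinj : Function.Injective σ := fun i j h => L.disj i j _ (hσ i) (by rw [h]; exact hσ j)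
  have hσsurj : Function.Surjective σ := Finite.surjective_of_injective hσinj
  have honly : ∀ i, ∀ v ∈ (L.path i).support, v ∈ Z → v = T.a (σ i) := by
    intro i v hv hvZ
    obtain ⟨j, rfl⟩ := hTsurj v hvZ
    obtain ⟨k, rfl⟩ := hσsurj j
    rw [L.disj i k _ hv (hσ k)]
  -- Following `L` up to `Z` and then `T` gives `s` walks from the first vertices of `L` to `F`,
  -- each of which must meet `Y`. They are disjoint, so `Y` has at least `s` vertices.
  have hζ : ∀ i, ∃ y ∈ Y, y ∈ ((L.path i).takeUntil _ (hσ i)).support ∨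
      y ∈ (T.path (σ i)).support := by
    intro i
    by_contra! hcon
    refine hYsep F hF hd.1 _ ⟨i, rfl⟩ _ (T.b_mem (σ i))
      ⟨((L.path i).takeUntil _ (hσ i)).append (T.path (σ i)), fun v hv hvY => ?_⟩
    rcases (Walk.mem_support_append_iff _ _).1 hv with hv | hv
    exacts [(hcon v hvY).1 hv, (hcon v hvY).2 hv]
  choose ζ hζY hζ using hζ
  -- A meeting point outside `Z` would give a walk from `W` to `F` that avoids `Z`.
  have hcross : ∀ i j v, v ∈ ((L.path i).takeUntil _ (hσ i)).support →
      v ∈ (T.path (σ j)).support → i = j := by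
    intro i j v hi hj
    have hi' := (L.path i).support_takeUntil_subset_support _ hi
    by_cases hvZ : v ∈ Z
    · exact hσinj (T.a_injective ((honly i v hi' hvZ).symm.trans (T.eq_a _ v hj hvZ)))
    · have h1 : G.ReachAvoiding Z (L.a i) v := by
        refine ⟨((L.path i).takeUntil _ (hσ i)).takeUntil v hi, fun w hw hwZ => ?_⟩
        have hw' := honly i w ((L.path i).support_takeUntil_subset_support _
          (Walk.support_takeUntil_subset_support _ _ hw)) hwZ
        subst hw'
        exact Walk.endpoint_notMem_support_takeUntil ((L.isPath i).takeUntil _) hi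
          (fun h => hvZ (h ▸ hwZ)) hw
      exact absurd (h1.trans (T.reverse.reachAvoiding (σ j) (by simpa [Linkage.reverse] using hj)
        subset_rfl hvZ).symm) (hsep F hF hd.2 _ (L.a_mem i) _ (T.b_mem _))
  have hζinj : Function.Injective ζ := by
    intro i j h
    rcases hζ i with hi | hi <;> rcases hζ j with hj | hj
    · exact L.disj i j _ ((L.path i).support_takeUntil_subset_support _ hi)
        (h ▸ (L.path j).support_takeUntil_subset_support _ hj)
    · exact hcross i j _ hi (h ▸ hj)
    · exact (hcross j i _ hj (h ▸ hi)).symm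
    · exact hσinj (T.disj _ _ _ hi (h ▸ hj))
  have := Finset.card_le_card (s := Finset.univ.image ζ) (t := Y) (by
    intro v hv
    obtain ⟨i, -, rfl⟩ := Finset.mem_image.1 hv
    exact hζY i)
  rw [Finset.card_image_of_injective _ hζinj, Finset.card_univ, Fintype.card_fin] at this
  omega

end CutNumber

end SimpleGraph

namespace SimpleGraph

variable {V : Type*} {G : SimpleGraph V}

/-! ### Subpaths and arcs of cycles -/

theorem Walk.IsPath.exists_suffix_start_mem {u v : V} {p : G.Walk u v} (hp : p.IsPath) {X : Set V}
    (hX : X.Nonempty) (hXp : ∀ x ∈ X, x ∈ p.support) :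
    ∃ a ∈ X, ∃ q : G.Walk a v, q.IsPath ∧ q.support ⊆ p.support ∧ ∀ x ∈ X, x ∈ q.support := by
  induction p with
  | @nil u =>
    obtain ⟨x, hx⟩ := hX
    have : x = u := by simpa using hXp x hx
    subst this
    exact ⟨x, hx, .nil, .nil, by simp, hXp⟩
  | @cons u w v h p ih =>
    by_cases hu : u ∈ X
    · exact ⟨u, hu, .cons h p, hp, fun _ h => h, hXp⟩
    · obtain ⟨a, ha, q, hq, hqp, hqX⟩ := ih hp.of_cons (fun x hx => by
        have := hXp x hx
        rw [Walk.support_cons, List.mem_cons] at this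
        exact this.resolve_left fun h => hu (h ▸ hx))
      exact ⟨a, ha, q, hq, fun z hz => by simp [hqp hz], hqX⟩

theorem Walk.IsPath.exists_subpath {u v : V} {p : G.Walk u v} (hp : p.IsPath) {X : Set V}
    (hX : X.Nonempty) (hXp : ∀ x ∈ X, x ∈ p.support) :
    ∃ a ∈ X, ∃ b ∈ X, ∃ q : G.Walk a b, q.IsPath ∧ q.support ⊆ p.support ∧
      ∀ x ∈ X, x ∈ q.support := by
  obtain ⟨a, ha, q, hq, hqp, hqX⟩ := hp.exists_suffix_start_mem hX hXp
  obtain ⟨b, hb, r, hr, hrq, hrX⟩ := hq.reverse.exists_suffix_start_mem hX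
    (fun x hx => by simpa using hqX x hx)
  exact ⟨a, ha, b, hb, r.reverse, hr.reverse,
    fun z hz => hqp (by simpa using hrq (by simpa using hz)), fun x hx => by simpa using hrX x hx⟩

theorem Walk.IsCycle.exists_arc {c : V} {C : G.Walk c c} (hC : C.IsCycle) {x y : V}
    (hx : x ∈ C.support) (hy : y ∈ C.support) (hxy : x ≠ y) :
    ∃ q : G.Walk x y, q.IsPath ∧ q.support ⊆ C.support ∧ C.length ≤ 2 * q.length := by
  classical
  have hC' : (C.rotate x hx).IsCycle := hC.rotate hx
  have hsup : ∀ z, z ∈ (C.rotate x hx).support ↔ z ∈ C.support :=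
    fun z => C.mem_support_rotate_iff x hx
  have hy' : y ∈ (C.rotate x hx).support := (hsup y).2 hy
  have hspec := (C.rotate x hx).take_spec hy'
  have hlen := congrArg Walk.length hspec
  rw [Walk.length_append, Walk.length_rotate] at hlen
  have hnil : ¬ ((C.rotate x hx).takeUntil y hy').Nil := fun h => hxy h.eq
  have hp2 : ((C.rotate x hx).dropUntil y hy').IsPath :=
    Walk.IsCycle.isPath_of_append_right hnil (by rw [hspec]; exact hC')
  by_cases hl : C.length ≤ 2 * ((C.rotate x hx).takeUntil y hy').length
  · exact ⟨_, hC'.isPath_takeUntil hy',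
      fun z hz => (hsup z).1 ((C.rotate x hx).support_takeUntil_subset_support hy' hz), hl⟩
  · refine ⟨_, hp2.reverse, fun z hz => (hsup z).1
      ((C.rotate x hx).support_dropUntil_subset_support hy' (by simpa using hz)), ?_⟩
    rw [Walk.length_reverse]
    omega

/-- Each further vertex raises the cut number by at most one, so the first prefix to reach `s` has
cut number exactly `s`. -/
theorem Walk.exists_take_cutNumber_eq [Fintype V] {𝓕 : Set (Set V)} {u v : V} (p : G.Walk u v)
    {s : ℕ} (hs : 0 < s) (hp : s ≤ G.cutNumber 𝓕 {x | x ∈ p.support}) :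
    ∃ n, G.cutNumber 𝓕 {x | x ∈ (p.take n).support} = s := by
  classical
  have hex : ∃ n, s ≤ G.cutNumber 𝓕 {x | x ∈ (p.take n).support} :=
    ⟨p.length, by
      rwa [Walk.support_take, List.take_of_length_le (by rw [Walk.length_support])]⟩
  refine ⟨Nat.find hex, le_antisymm ?_ (Nat.find_spec hex)⟩
  rcases Nat.eq_zero_or_pos (Nat.find hex) with h0 | hpos
  · rw [h0]
    have h1 := cutNumber_le_card (G := G) (𝓕 := 𝓕) {u}
    refine (cutNumber_mono (Y := (({u} : Finset V) : Set V)) ?_).trans (h1.trans ?_)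
    · intro x hx
      simpa using hx
    · simpa using Nat.succ_le_of_lt hs
  · obtain ⟨n, hn⟩ := Nat.exists_eq_succ_of_ne_zero hpos.ne'
    have hlt := Nat.find_min hex (m := n) (by omega)
    rw [hn]
    have h1 := cutNumber_le_card (G := G) (𝓕 := 𝓕) {p.getVert (n + 1)}
    refine (cutNumber_mono (Y := {x | x ∈ (p.take n).support} ∪
      (({p.getVert (n + 1)} : Finset V) : Set V)) ?_).trans (cutNumber_union_le.trans ?_)
    · intro x hx
      obtain ⟨k, hk, hk'⟩ := Walk.mem_support_iff_exists_getVert.1 hx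
      rw [Walk.take_getVert] at hk
      rw [Walk.take_length] at hk'
      rcases Nat.lt_or_ge n k with h | h
      · right
        have : k = n + 1 := by omega
        subst this
        rw [min_self] at hk
        simp [hk]
      · left
        refine Walk.mem_support_iff_exists_getVert.2 ⟨k, ?_, ?_⟩
        · rw [Walk.take_getVert, ← hk]
          congr 1
          omega
        · rw [Walk.take_length]
          omega
    · rw [Finset.card_singleton] at h1
      omega

/-! ### The counting argument -/

theorem Linkage.card_mul_le [Fintype V] {A B : Set V} {ι : Type*} (L : G.Linkage A B ι)
    (I : Finset ι) {b : ℕ} (hI : ∀ i ∈ I, b ≤ (L.path i).support.length) :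
    I.card * b ≤ Fintype.card V := by
  classical
  have h : (I.biUnion fun i => (L.path i).support.toFinset).card =
      ∑ i ∈ I, (L.path i).support.toFinset.card := by
    refine Finset.card_biUnion fun i _ j _ hij => Finset.disjoint_left.2 fun v hv hv' => hij ?_
    exact L.disj i j v (by simpa using hv) (by simpa using hv')
  calc I.card * b = ∑ _i ∈ I, b := by simp
    _ ≤ ∑ i ∈ I, (L.path i).support.toFinset.card := Finset.sum_le_sum fun i hi => by
        rw [List.toFinset_card_of_nodup (L.isPath i).support_nodup]
        exact hI i hi
    _ ≤ Fintype.card V := h ▸ Finset.card_le_univ _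

/-- Roles of the parameters: linking paths with more than `b` vertices are discarded, `ℓ` bounds the
chunks of `F₁` and `D` those of `F₂`. `hs` forces `2 * D` short paths into one chunk of `F₁`, `hsum`
keeps the cut number of the cycle below `t`, and `hDK` is the pigeonhole condition for `F₂`. -/
theorem not_exists_large_cutNumber [Fintype V] {𝓕 : Set (Set V)} {t s ℓ b D K K' : ℕ}
    (ht : ∀ S : Finset V, (∀ F ∈ 𝓕, ∃ z ∈ S, z ∈ F) → t ≤ S.card)
    (hconn : ∀ F ∈ 𝓕, ∀ Z : Set V, Disjoint Z F → ∀ x ∈ F, ∀ y ∈ F, G.ReachAvoiding Z x y)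
    (hint : ∀ F ∈ 𝓕, ∀ F' ∈ 𝓕, (F ∩ F').Nonempty)
    (hK : ∀ F ∈ 𝓕, G.HasChunks F ℓ K) (hK' : ∀ F ∈ 𝓕, G.HasChunks F D K')
    (h2s : 2 * s ≤ t) (hD : 0 < D) (hDK : K' < 2 * D) (hsum : s + ℓ + 2 * b < t)
    (hs : K * (2 * D - 1) + Fintype.card V / (b + 1) < s)
    {u v : V} {p : G.Walk u v} (hp : p.IsPath) (hps : s ≤ G.cutNumber 𝓕 {x | x ∈ p.support}) :
    False := by
  classical
  have hs0 : 0 < s := (Nat.zero_le _).trans_lt hs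
  obtain ⟨n, hn⟩ := p.exists_take_cutNumber_eq hs0 hps
  have hw : (p.take n).IsPath := hp.take n
  generalize p.take n = w at hn hw
  obtain ⟨F₁, hF₁, hd₁, L, hL⟩ :=
    exists_linkage_forall_card_le_cutNumber ht (by omega) hconn hint hn h2s
  obtain ⟨χ, hχ⟩ := hK F₁ hF₁
  have hlong := L.card_mul_le (Finset.univ.filter fun i => ¬ (L.path i).support.length ≤ b)
    (b := b + 1) (fun i hi => by simpa using hi)
  rw [← Nat.le_div_iff_mul_le (by omega)] at hlong
  generalize Fintype.card V / (b + 1) = N at hs hlong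
  have hadd := Finset.card_filter_add_card_filter_not (s := (Finset.univ : Finset (Fin s)))
    (fun i => (L.path i).support.length ≤ b)
  rw [Finset.card_univ, Fintype.card_fin] at hadd
  obtain ⟨c, -, hc⟩ := Finset.exists_lt_card_fiber_of_mul_lt_card_of_maps_to
    (s := Finset.univ.filter fun i => (L.path i).support.length ≤ b) (t := Finset.univ)
    (f := fun i => χ (L.b i)) (n := 2 * D - 1) (fun _ _ => Finset.mem_univ _)
    (by rw [Finset.card_univ, Fintype.card_fin]; omega)
  set I := (Finset.univ.filter fun i => (L.path i).support.length ≤ b).filter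
    fun i => χ (L.b i) = c with hI
  have hIb : ∀ i ∈ I, (L.path i).support.length ≤ b ∧ χ (L.b i) = c := by
    intro i hi
    simpa [hI] using hi
  have hIne : I.Nonempty := Finset.card_pos.1 (by omega)
  -- The shortened path still passes through all first vertices of `I`, which makes the cycle below
  -- both long and of cut number at least `2 * D`.
  obtain ⟨_, ⟨i, hiI, rfl⟩, _, ⟨j, hjI, rfl⟩, q₁, hq₁, hq₁w, hq₁I⟩ :=
    hw.exists_subpath (X := L.a '' I) (by simpa using hIne)
      (by rintro _ ⟨i, -, rfl⟩; exact L.a_mem i)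
  have hq₁len : I.card ≤ q₁.length + 1 := by
    rw [← Finset.card_image_of_injective I L.a_injective, ← Walk.length_support]
    refine (Finset.card_le_card (t := q₁.support.toFinset) fun x hx => ?_).trans
      (List.toFinset_card_le _)
    rw [List.mem_toFinset]
    exact hq₁I x (by simpa using hx)
  have hij : i ≠ j := by
    rintro rfl
    have := Walk.length_eq_zero_iff.2 (Walk.isPath_iff_nil.1 hq₁)
    omega
  obtain ⟨q, hq, hqF, hqℓ, -⟩ := hχ _ (L.b_mem i) _ (L.b_mem j)
    (fun h => hij (L.b_injective h)) ((hIb i hiI).2.trans (hIb j hjI).2.symm)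
  obtain ⟨q₂, hq₂, hq₂len, hq₂w, hq₂s⟩ : ∃ q₂ : G.Walk (L.a i) (L.a j), q₂.IsPath ∧
      q.length + 2 ≤ q₂.length ∧
      (∀ v ∈ q₂.support, v ∈ w.support → v = L.a i ∨ v = L.a j) ∧
      ∀ v ∈ q₂.support, v ∈ (L.path i).support ∨ v ∈ q.support ∨ v ∈ (L.path j).support := by
    simpa [Linkage.reverse] using L.reverse.exists_detour hd₁.symm hij (q := q) hq hqF
  have hC : (q₁.append q₂.reverse).IsCycle := by
    refine hq₁.isCycle_append hq₂.reverse (fun z hz hz' => ?_)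
      (Or.inr (by rw [Walk.length_reverse]; omega))
    have hz₂ := List.mem_of_mem_tail hz'
    rw [Walk.support_reverse, List.mem_reverse] at hz₂
    rcases hq₂w z hz₂ (hq₁w (List.mem_of_mem_tail hz)) with rfl | rfl
    · exact Walk.start_notMem_tail_support hq₁ hz
    · exact Walk.start_notMem_tail_support hq₂.reverse hz'
  have hClen : 2 * D + 1 ≤ (q₁.append q₂.reverse).length := by
    rw [Walk.length_append, Walk.length_reverse]
    omega
  have hCsup : ∀ z, z ∈ (q₁.append q₂.reverse).support ↔ z ∈ q₁.support ∨ z ∈ q₂.support := by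
    intro z
    rw [Walk.mem_support_append_iff, Walk.support_reverse, List.mem_reverse]
  generalize q₁.append q₂.reverse = C at hC hClen hCsup
  have hCcut : G.cutNumber 𝓕 {x | x ∈ C.support} < t := by
    set S : Finset V := ((L.path i).support ++ (q.support ++ (L.path j).support)).toFinset with hS
    have hScard : S.card ≤ b + (ℓ + b) := by
      refine (List.toFinset_card_le _).trans ?_
      simp only [List.length_append, Walk.length_support q]
      have := (hIb i hiI).1
      have := (hIb j hjI).1
      omega
    have hsub : {x | x ∈ C.support} ⊆ {x | x ∈ w.support} ∪ (S : Set V) := by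
      intro x hx
      rcases (hCsup x).1 hx with hx | hx
      · exact Or.inl (hq₁w hx)
      · exact Or.inr (by simpa [hS] using hq₂s x hx)
    have h1 := cutNumber_mono (G := G) (𝓕 := 𝓕) hsub
    have h2 := cutNumber_union_le (G := G) (𝓕 := 𝓕) (X := {x | x ∈ w.support}) (Y := (S : Set V))
    have h3 := cutNumber_le_card (G := G) (𝓕 := 𝓕) S
    omega
  have hCcut' : 2 * D ≤ G.cutNumber 𝓕 {x | x ∈ C.support} := by
    have h1 := hL I
    have h2 : L.a '' I ⊆ {x | x ∈ C.support} := fun x hx => (hCsup x).2 (Or.inl (hq₁I x hx))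
    have h3 := cutNumber_mono (G := G) (𝓕 := 𝓕) h2
    omega
  obtain ⟨F₂, hF₂, hd₂⟩ := exists_disjoint_of_cutNumber_lt ht hCcut
  obtain ⟨T⟩ := exists_linkage_of_le_cutNumber hconn hint hF₂ hCcut'
  obtain ⟨χ', hχ'⟩ := hK' F₂ hF₂
  obtain ⟨x, y, hxy, hxy'⟩ := Fintype.exists_ne_map_eq_of_card_lt (fun x => χ' (T.b x))
    (by simpa using hDK)
  obtain ⟨r, -, -, hrD, hmax⟩ := hχ' _ (T.b_mem x) _ (T.b_mem y)
    (fun h => hxy (T.b_injective h)) hxy'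
  -- The longer arc has more than `D` edges, whereas the segment `r` of `F₂` has fewer.
  obtain ⟨d, hd, hdC, hdlen⟩ := hC.exists_arc (T.a_mem x) (T.a_mem y)
    (fun h => hxy (T.a_injective h))
  obtain ⟨d', hd', hdlen', hdF, -⟩ := T.exists_detour hd₂ hxy hd hdC
  have := hmax d' hd' hdF
  omega

end SimpleGraph

/-! ### Arithmetic of the parameters -/

/-- The choices are `D = √n + 1`, `ℓ = t / 4`, `b = t / 16` and `s = t / (2 * m)`. There are about
`n / t` chunks, each taking about `2√n` paths, so the main demand is that `t ^ 2` exceed a multiple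
of `m * n * √n`. The bound `t ≤ n` forces `n > 4096 * m ^ 5`, which absorbs the terms in `m`. -/
theorem Nat.transversal_bounds {m n t : ℕ} (hm : 1 ≤ m) (htn : t ≤ n)
    (ht : 4096 * m ^ 5 * n ^ 3 < t ^ 4) :
    (n + m) / (n.sqrt + 1) + m < 2 * (n.sqrt + 1) ∧
    ((n + m) / (t / 4) + m) * (2 * (n.sqrt + 1) - 1) + n / (t / 16 + 1) < t / (2 * m) ∧
    16 ≤ t := by
  set E := n.sqrt with hE
  have hE1 : E * E ≤ n := Nat.sqrt_le n
  have hE2 : n < (E + 1) * (E + 1) := Nat.lt_succ_sqrt n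
  have hn0 : 0 < n := by
    rcases Nat.eq_zero_or_pos n with rfl | h
    · simp [Nat.le_zero.1 htn] at ht
    · exact h
  have hm45 : m ^ 4 ≤ m ^ 5 := Nat.pow_le_pow_right hm (by norm_num)
  have hmn : 4096 * m ^ 5 < n := by
    have h1 : t ^ 4 ≤ n ^ 4 := Nat.pow_le_pow_left htn 4
    have h2 : 4096 * m ^ 5 * n ^ 3 < n * n ^ 3 := by
      calc _ < t ^ 4 := ht
        _ ≤ n ^ 4 := h1
        _ = n * n ^ 3 := by ring
    exact lt_of_mul_lt_mul_right h2 (Nat.zero_le _)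
  have hmE : 64 * m ^ 2 ≤ E := by
    by_contra! h
    have h1 : (E + 1) * (E + 1) ≤ (64 * m ^ 2) * (64 * m ^ 2) := Nat.mul_le_mul h h
    have h2 : (64 * m ^ 2) * (64 * m ^ 2) = 4096 * m ^ 4 := by ring
    omega
  have hm2 : m ≤ m ^ 2 := Nat.le_self_pow (by norm_num) m
  have ht2 : 64 * m ^ 2 * n * E < t ^ 2 := by
    refine lt_of_pow_lt_pow_left₀ 2 (Nat.zero_le _) ?_
    calc (64 * m ^ 2 * n * E) ^ 2 = 4096 * m ^ 4 * n ^ 2 * (E * E) := by ring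
      _ ≤ 4096 * m ^ 5 * n ^ 2 * n := by gcongr
      _ = 4096 * m ^ 5 * n ^ 3 := by ring
      _ < t ^ 4 := ht
      _ = (t ^ 2) ^ 2 := by ring
  have ht1 : 64 * m ^ 2 * E < t := by
    refine lt_of_pow_lt_pow_left₀ 2 (Nat.zero_le _) ?_
    calc (64 * m ^ 2 * E) ^ 2 = 64 * m ^ 2 * (E * E) * (64 * m ^ 2) := by ring
      _ ≤ 64 * m ^ 2 * n * E := by gcongr
      _ < t ^ 2 := ht2
  have hE64 : 64 ≤ E := by omega
  have htE : 64 * E ≤ t := by nlinarith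
  refine ⟨?_, ?_, by omega⟩
  · have h1 : (n + m) / (E + 1) < E + 2 := by
      rw [Nat.div_lt_iff_lt_mul (by omega)]
      nlinarith
    omega
  · have hk1 : (n + m) / (t / 4) * t ≤ 6 * n := by
      have h1 := Nat.div_mul_le_self (n + m) (t / 4)
      have h2 : t ≤ 5 * (t / 4) := by omega
      have h3 : 5 * m ≤ n := by omega
      calc (n + m) / (t / 4) * t ≤ (n + m) / (t / 4) * (5 * (t / 4)) := by gcongr
        _ = 5 * ((n + m) / (t / 4) * (t / 4)) := by ring
        _ ≤ 5 * (n + m) := by gcongr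
        _ ≤ 6 * n := by omega
    have hk2 : n / (t / 16 + 1) * t ≤ 16 * n := by
      have h1 := Nat.div_mul_le_self n (t / 16 + 1)
      have h2 : t ≤ 16 * (t / 16 + 1) := by omega
      calc n / (t / 16 + 1) * t ≤ n / (t / 16 + 1) * (16 * (t / 16 + 1)) := by gcongr
        _ = 16 * (n / (t / 16 + 1) * (t / 16 + 1)) := by ring
        _ ≤ 16 * n := by gcongr
    generalize (n + m) / (t / 4) = k₁ at hk1
    generalize n / (t / 16 + 1) = k₂ at hk2
    have hF : 2 * (E + 1) - 1 = 2 * E + 1 := by omega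
    rw [hF, ← Nat.succ_le_iff, Nat.le_div_iff_mul_le (by omega), Nat.succ_eq_add_one]
    have ht0 : 0 < t := by omega
    refine le_of_mul_le_mul_right ?_ ht0
    have hmm : m * n * E ≤ m ^ 2 * n * E := by gcongr
    have hmn64 : m * n * 64 ≤ m * n * E := by gcongr
    have hmt : m * t * 64 ≤ m ^ 2 * E * t := by
      calc m * t * 64 ≤ m ^ 2 * t * E := by gcongr
        _ = m ^ 2 * E * t := by ring
    have hmt2 : m ^ 2 * t * 64 ≤ m ^ 2 * E * t := by
      calc m ^ 2 * t * 64 ≤ m ^ 2 * t * E := by gcongr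
        _ = m ^ 2 * E * t := by ring
    have htt : 64 * (m ^ 2 * E * t) ≤ t ^ 2 := by
      calc 64 * (m ^ 2 * E * t) = 64 * m ^ 2 * E * t := by ring
        _ ≤ t * t := by gcongr
        _ = t ^ 2 := by ring
    calc ((k₁ + m) * (2 * E + 1) + k₂ + 1) * (2 * m) * t
        = 2 * m * ((k₁ * t) * (2 * E + 1) + k₂ * t + m * t * (2 * E + 1) + t) := by ring
      _ ≤ 2 * m * ((6 * n) * (2 * E + 1) + 16 * n + m * t * (2 * E + 1) + t) := by gcongr
      _ = 24 * (m * n * E) + 44 * (m * n) + 4 * (m ^ 2 * E * t) + 2 * (m ^ 2 * t)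
          + 2 * (m * t) := by ring
      _ ≤ t ^ 2 := by nlinarith
      _ = t * t := by ring

/-! ### Intersection of maximum subdivisions and small transversals -/

namespace Graph

open SimpleGraph

variable {α β V : Type*} {R : Graph α β} {G : SimpleGraph V}

theorem IsConnectedMultigraph.noIsolatedVertex (h : R.IsConnectedMultigraph)
    (hE : R.edgeSet.Nonempty) : R.NoIsolatedVertex := by
  intro x hx
  obtain ⟨e, he⟩ := hE
  obtain ⟨u, v, huv⟩ := R.exists_isLink_of_mem_edgeSet he
  rcases Relation.ReflTransGen.cases_head (h.2 x hx u huv.left_mem) with rfl | ⟨y, ⟨f, hf⟩, -⟩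
  · exact ⟨e, huv.inc_left⟩
  · exact ⟨f, hf.inc_left⟩

theorem SubdivisionModel.inter_verts_nonempty [Fintype V] [Fintype R.edgeSet] [Nonempty R.edgeSet]
    (hR : R.NoIsolatedVertex) (hG : G.IsVertexConnected (Fintype.card R.edgeSet ^ 2 + 1))
    (M₁ M₂ : R.SubdivisionModel G) (h₁ : R.IsMaxSubdivision M₁.toSubgraph)
    (h₂ : R.IsMaxSubdivision M₂.toSubgraph) :
    (M₁.toSubgraph.verts ∩ M₂.toSubgraph.verts).Nonempty := by
  rw [← Set.not_disjoint_iff_nonempty_inter]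
  -- With this block length the quotient in the number of colours vanishes, leaving one colour per
  -- edge of `R`.
  have hc₁ := M₁.hasChunks hR h₁ (Nat.succ_pos (Fintype.card V + Fintype.card R.edgeSet))
  have hc₂ := M₂.hasChunks hR h₂ (Nat.succ_pos (Fintype.card V + Fintype.card R.edgeSet))
  rw [Nat.div_eq_of_lt (Nat.lt_succ_self _), zero_add] at hc₁ hc₂
  have hex : ∀ M : R.SubdivisionModel G, R.IsMaxSubdivision M.toSubgraph → ∀ Z : Finset V,
      Z.card < Fintype.card R.edgeSet ^ 2 + 1 → ∃ x ∈ M.toSubgraph.verts, x ∉ Z := by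
    intro M hM Z hZ
    exact Set.exists_mem_notMem_of_ncard_lt_ncard (s := (Z : Set V))
      (by rw [Set.ncard_coe_finset]; exact hZ.trans_le (M.le_ncard_verts hM hG))
      (Finset.finite_toSet Z)
  obtain ⟨L⟩ := G.exists_linkage M₁.toSubgraph.verts M₂.toSubgraph.verts
    (Fintype.card R.edgeSet ^ 2 + 1) (by
      intro Z hZ
      by_contra! hlt
      obtain ⟨x, hx, hxZ⟩ := hex M₁ h₁ Z hlt
      obtain ⟨y, hy, hyZ⟩ := hex M₂ h₂ Z hlt
      exact hZ x hx y hy (hG.reachAvoiding hlt hxZ hyZ))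
  exact hc₁.not_disjoint hc₂ L

/-- The vertex sets of the maximum subdivisions. -/
def maxSubdivisionSupports (R : Graph α β) (G : SimpleGraph V) : Set (Set V) :=
  {F | ∃ M : R.SubdivisionModel G, R.IsMaxSubdivision M.toSubgraph ∧ M.toSubgraph.verts = F}

/-- Maximum subdivisions of a connected multigraph with `m` edges that pairwise intersect cannot
all be missed by sets of size up to `8 m ^ (5 / 4) n ^ (3 / 4)`. -/
theorem not_forall_le_card_of_isMaxSubdivision [Fintype V] [Fintype R.edgeSet]
    [Nonempty R.edgeSet] (hR : R.IsConnectedMultigraph) (M : R.SubdivisionModel G)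
    (hM : R.IsMaxSubdivision M.toSubgraph)
    (hint : ∀ F ∈ R.maxSubdivisionSupports G, ∀ F' ∈ R.maxSubdivisionSupports G,
      (F ∩ F').Nonempty) {t : ℕ}
    (ht : ∀ S : Finset V, (∀ F ∈ R.maxSubdivisionSupports G, ∃ z ∈ S, z ∈ F) → t ≤ S.card) :
    t ^ 4 ≤ 4096 * Fintype.card R.edgeSet ^ 5 * Fintype.card V ^ 3 := by
  by_contra! hlt
  have hm : 1 ≤ Fintype.card R.edgeSet := Fintype.card_pos
  have hR' : R.NoIsolatedVertex := hR.noIsolatedVertex (Set.nonempty_coe_sort.1 ‹_›)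
  have hMF : M.toSubgraph.verts ∈ R.maxSubdivisionSupports G := ⟨M, hM, rfl⟩
  have htn : t ≤ Fintype.card V := by
    refine ht Finset.univ fun F hF => ?_
    obtain ⟨z, hz, -⟩ := hint F hF F hF
    exact ⟨z, Finset.mem_univ z, hz⟩
  obtain ⟨hb1, hb2, hb3⟩ := Nat.transversal_bounds hm htn hlt
  have hconn : ∀ F ∈ R.maxSubdivisionSupports G, ∀ Z : Set V, Disjoint Z F → ∀ x ∈ F, ∀ y ∈ F,
      G.ReachAvoiding Z x y := by
    rintro _ ⟨N, -, rfl⟩ Z hZ x hx y hy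
    exact N.reachAvoiding_of_isConnectedMultigraph hR hR' hZ hx hy
  have hchunk : ∀ ℓ, 0 < ℓ → ∀ F ∈ R.maxSubdivisionSupports G, G.HasChunks F ℓ
      ((Fintype.card V + Fintype.card R.edgeSet) / ℓ + Fintype.card R.edgeSet) := by
    rintro ℓ hℓ _ ⟨N, hN, rfl⟩
    exact N.hasChunks hR' hN hℓ
  obtain ⟨a, b, q, hq, hcov⟩ := M.verts_subset_iUnion_path hR'
  -- By subadditivity some path would even have cut number `t / m`; the factor 2 provides `2 * s ≤
  -- t` when `m = 1`.
  obtain ⟨e, he⟩ : ∃ e, t / (2 * Fintype.card R.edgeSet) ≤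
      G.cutNumber (R.maxSubdivisionSupports G) {x | x ∈ (q e).support} := by
    by_contra! hcon
    have h1 := le_cutNumber_of_mem (G := G) ht hint hMF
    have h2 := cutNumber_iUnion_le (G := G) (𝓕 := R.maxSubdivisionSupports G) Finset.univ
      (fun e => {x | x ∈ (q e).support})
    have h3 : M.toSubgraph.verts ⊆ ⋃ e ∈ (Finset.univ : Finset R.edgeSet),
        {x | x ∈ (q e).support} := by
      intro z hz
      obtain ⟨e, he⟩ := hcov z hz
      exact Set.mem_iUnion₂.2 ⟨e, Finset.mem_univ e, he⟩
    have h4 : ∑ e, G.cutNumber (R.maxSubdivisionSupports G) {x | x ∈ (q e).support} ≤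
        Fintype.card R.edgeSet * (t / (2 * Fintype.card R.edgeSet)) := by
      rw [← smul_eq_mul, ← Finset.card_univ]
      exact Finset.sum_le_card_nsmul _ _ _ fun e _ => (hcon e).le
    have h5 := Nat.div_mul_le_self t (2 * Fintype.card R.edgeSet)
    have h6 := (h1.trans (cutNumber_mono h3)).trans (h2.trans h4)
    nlinarith
  have hs2 : 2 * (t / (2 * Fintype.card R.edgeSet)) ≤ t := by
    have h5 := Nat.div_mul_le_self t (2 * Fintype.card R.edgeSet)
    nlinarith
  exact not_exists_large_cutNumber (b := t / 16) ht hconn hint (hchunk (t / 4) (by omega))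
    (hchunk ((Fintype.card V).sqrt + 1) (Nat.succ_pos _)) hs2 (Nat.succ_pos _) hb1 (by omega) hb2
    (hq e) he

end Graph

theorem corollary4 {α β V : Type*} [Fintype V] (R : Graph α β) (G : SimpleGraph V) (m n : ℕ)
    (hm : 1 ≤ m) (hR : R.edgeSet.encard = m) (hn : Fintype.card V = n)
    (hG : m ^ 2 < G.vertexConnectivity) :
    (R.NoIsolatedVertex →
      ∀ F₁ F₂ : G.Subgraph, R.IsMaxSubdivision F₁ → R.IsMaxSubdivision F₂ →
        (F₁.verts ∩ F₂.verts).Nonempty) ∧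
    (R.IsConnectedMultigraph →
      ∃ S : Finset V, R.IsTransversal G S ∧
        (S.card : ℝ) ≤ 8 * (m : ℝ) ^ (5 / 4 : ℝ) * (n : ℝ) ^ (3 / 4 : ℝ)) := by
  have hfin : R.edgeSet.Finite := Set.finite_of_encard_eq_coe hR
  have := hfin.fintype
  have hcard : Fintype.card R.edgeSet = m := by
    rw [Set.encard_eq_coe_toFinset_card, Set.toFinset_card] at hR
    exact_mod_cast hR
  have hne : Nonempty R.edgeSet := Fintype.card_pos_iff.1 (by omega)
  have hconn : G.IsVertexConnected (Fintype.card R.edgeSet ^ 2 + 1) := by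
    obtain ⟨h1, h2⟩ := G.isGreatest_vertexConnectivity.1
    rw [hcard]
    exact ⟨hG.trans_le h1, fun S hS => h2 S (hS.trans_le hG)⟩
  have part1 : R.NoIsolatedVertex →
      ∀ F₁ F₂ : G.Subgraph, R.IsMaxSubdivision F₁ → R.IsMaxSubdivision F₂ →
        (F₁.verts ∩ F₂.verts).Nonempty := by
    rintro hR' _ _ h₁ h₂
    obtain ⟨M₁, rfl⟩ := h₁.1
    obtain ⟨M₂, rfl⟩ := h₂.1
    exact M₁.inter_verts_nonempty hR' hconn M₂ h₁ h₂
  refine ⟨part1, fun hRc => ?_⟩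
  have hR' := hRc.noIsolatedVertex (Set.nonempty_coe_sort.1 hne)
  by_contra! hcon
  set B : ℝ := 8 * (m : ℝ) ^ (5 / 4 : ℝ) * (n : ℝ) ^ (3 / 4 : ℝ) with hB
  have hB0 : 0 ≤ B := by positivity
  have hB4 : B ^ 4 = 4096 * (m : ℝ) ^ 5 * (n : ℝ) ^ 3 := by
    rw [hB, mul_pow, mul_pow, ← Real.rpow_natCast ((m : ℝ) ^ (5 / 4 : ℝ)),
      ← Real.rpow_natCast ((n : ℝ) ^ (3 / 4 : ℝ)), ← Real.rpow_mul (Nat.cast_nonneg m),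
      ← Real.rpow_mul (Nat.cast_nonneg n), ← Real.rpow_natCast (m : ℝ) 5,
      ← Real.rpow_natCast (n : ℝ) 3]
    norm_num
  obtain ⟨F, hF⟩ : ∃ F : G.Subgraph, R.IsMaxSubdivision F := by
    by_contra! h
    -- If there is no maximum subdivision, the empty set is a transversal.
    have := hcon ∅ (fun F hF => absurd hF (h F))
    simp only [Finset.card_empty, Nat.cast_zero] at this
    exact absurd hB0 (not_le.2 this)
  obtain ⟨M, rfl⟩ := hF.1
  -- All transversals are larger than `B`, so `t` can be `⌊B⌋₊ + 1`; its fourth power exceeds `B ^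
  -- 4`, which is exactly the bound obtained.
  have hle := Graph.not_forall_le_card_of_isMaxSubdivision hRc M hF (by
      rintro _ ⟨M₁, h₁, rfl⟩ _ ⟨M₂, h₂, rfl⟩
      exact part1 hR' _ _ h₁ h₂) (t := ⌊B⌋₊ + 1) (by
      intro S hS
      have := hcon S (by
        rintro _ hF'
        obtain ⟨M', rfl⟩ := hF'.1
        exact hS _ ⟨M', hF', rfl⟩)
      exact Nat.succ_le_of_lt ((Nat.floor_lt hB0).2 this))
  rw [hcard, hn] at hle
  have hle' : ((⌊B⌋₊ + 1 : ℕ) : ℝ) ^ 4 ≤ B ^ 4 := by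
    rw [hB4]
    exact_mod_cast hle
  have hlt : B < ((⌊B⌋₊ + 1 : ℕ) : ℝ) := by
    exact_mod_cast Nat.lt_floor_add_one B
  exact absurd hle' (not_le.2 (pow_lt_pow_left₀ hlt hB0 (by norm_num)))
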